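/- Let $\mathcal H=L^2(\mathbb R)$, with $(Q\psi)(x)=x\psi(x)$, $P=-i\,d/dx$, $a=\tfrac1{\sqrt2}(Q+iP)$, and let $W(q,p)=e^{iqp/2}e^{-iqP}e^{ipQ}$ be the Weyl operators. For $\theta\in\mathbb R$ let $\mathsf Q_\theta$ be the spectral measure of the quadrature $Q_\theta$, the closure of $\tfrac1{\sqrt2}(e^{i\theta}a^*+e^{-i\theta}a)$ on Schwartz functions, and put $\mathsf Q=\mathsf Q_0$. Let $U$ be the beam splitter on $\mathcal H\otimes\mathcal H=L^2(\mathbb R^2)$, $(U\Psi)(x,y)=\Psi\big(\tfrac1{\sqrt2}(x+y),\tfrac1{\sqrt2}(-x+y)\big)$. A state is a positive operator of trace one; an observable on $\mathbb R^2$ is a normalized positive operator measure on the Borel sets of $\mathbb R^2$. Let $\theta\in\mathbb R$ and let $\sigma$ be a state on $\mathcal H$. There is exactly one observable $\mathsf E_{\theta,\sigma}$ on $\mathbb R^2$ such that $$\operatorname{tr}[\rho\,\mathsf E_{\theta,\sigma}(X\times Y)]=\operatorname{tr}\big[U(\rho\otimes\sigma)U^*\,\mathsf Q(\tfrac1{\sqrt2}X)\otimes\mathsf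 Q_\theta(\tfrac1{\sqrt2}Y)\big]$$ for all states $\rho$ and all Borel sets $X,Y\subseteq\mathbb R$. For all $q,p\in\mathbb R$ and all Borel sets $Z\subseteq\mathbb R^2$ it satisfies $$W(q,p)\,\mathsf E_{\theta,\sigma}(Z)\,W(q,p)^*=\mathsf E_{\theta,\sigma}\big(Z+(q,\;q\cos\theta+p\sin\theta)\big).$$ Moreover $\mathsf E_{\theta,\sigma}$ is covariant, that is, $W(q,p)\mathsf E_{\theta,\sigma}(Z)W(q,p)^*=\mathsf E_{\theta,\sigma}(Z+(q,p))$ for all $q,p\in\mathbb R$ and all Borel $Z\subseteq\mathbb R^2$, if and only if $\theta\equiv\tfrac\pi2\pmod{2\pi}$; in particular, for $\theta\in(-\pi,\pi]$, if and only if $\theta=\tfrac\pi2$. -/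

import Mathlib

open MeasureTheory
open scoped SchwartzMap ENNReal InnerProductSpace TensorProduct

noncomputable section

namespace EightPort

/-! ### The Hilbert spaces (coordinate representation) -/

/-- The Hilbert space of a single mode, `L²(ℝ)`. -/
abbrev H : Type := Lp ℂ 2 (volume : Measure ℝ)

/-- The Hilbert space of two modes, `L²(ℝ) ⊗ L²(ℝ) = L²(ℝ²)`. -/
abbrev H₂ : Type := Lp ℂ 2 (volume : Measure (ℝ × ℝ))

theorem memLp_tprod (f g : H) :
    MemLp (fun z : ℝ × ℝ => f z.1 * g z.2) 2 (volume : Measure (ℝ × ℝ)) := by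
  have hm : AEStronglyMeasurable (fun z : ℝ × ℝ => f z.1 * g z.2)
      (volume : Measure (ℝ × ℝ)) :=
    (Lp.aestronglyMeasurable f).comp_fst.mul (Lp.aestronglyMeasurable g).comp_snd
  rw [memLp_two_iff_integrable_sq_norm hm]
  have hf := (memLp_two_iff_integrable_sq_norm (Lp.aestronglyMeasurable f)).1 (Lp.memLp f)
  have hg := (memLp_two_iff_integrable_sq_norm (Lp.aestronglyMeasurable g)).1 (Lp.memLp g)
  simpa [mul_pow, Measure.volume_eq_prod] using hf.mul_prod hg

/-- The product vector `f ⊗ g`, i.e. the function `(x, y) ↦ f x * g y`. -/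
def tprod (f g : H) : H₂ := (memLp_tprod f g).toLp _

theorem tprod_coeFn (f g : H) :
    tprod f g =ᵐ[(volume : Measure (ℝ × ℝ))] fun z => f z.1 * g z.2 :=
  MemLp.coeFn_toLp _

/-- `(f, g) ↦ f ⊗ g` as a bilinear map. -/
def tprodₗ : H →ₗ[ℂ] H →ₗ[ℂ] H₂ :=
  LinearMap.mk₂ ℂ tprod
    (fun f f' g => by
      have h := (Measure.quasiMeasurePreserving_fst (μ := (volume : Measure ℝ))
        (ν := (volume : Measure ℝ))).ae_eq_comp (Lp.coeFn_add f f')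
      ext1
      filter_upwards [tprod_coeFn (f + f') g, Lp.coeFn_add (tprod f g) (tprod f' g),
        tprod_coeFn f g, tprod_coeFn f' g, h] with z h1 h2 h3 h4 h5
      simp only [Function.comp_apply, Pi.add_apply] at h5
      rw [h1, h2, Pi.add_apply, h3, h4, h5, add_mul])
    (fun c f g => by
      have h := (Measure.quasiMeasurePreserving_fst (μ := (volume : Measure ℝ))
        (ν := (volume : Measure ℝ))).ae_eq_comp (Lp.coeFn_smul c f)
      ext1
      filter_upwards [tprod_coeFn (c • f) g, Lp.coeFn_smul c (tprod f g),
        tprod_coeFn f g, h] with z h1 h2 h3 h5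
      simp only [Function.comp_apply, Pi.smul_apply] at h5
      rw [h1, h2, Pi.smul_apply, h3, h5, smul_mul_assoc])
    (fun f g g' => by
      have h := (Measure.quasiMeasurePreserving_snd (μ := (volume : Measure ℝ))
        (ν := (volume : Measure ℝ))).ae_eq_comp (Lp.coeFn_add g g')
      ext1
      filter_upwards [tprod_coeFn f (g + g'), Lp.coeFn_add (tprod f g) (tprod f g'),
        tprod_coeFn f g, tprod_coeFn f g', h] with z h1 h2 h3 h4 h5
      simp only [Function.comp_apply, Pi.add_apply] at h5
      rw [h1, h2, Pi.add_apply, h3, h4, h5, mul_add])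
    (fun c f g => by
      have h := (Measure.quasiMeasurePreserving_snd (μ := (volume : Measure ℝ))
        (ν := (volume : Measure ℝ))).ae_eq_comp (Lp.coeFn_smul c g)
      ext1
      filter_upwards [tprod_coeFn f (c • g), Lp.coeFn_smul c (tprod f g),
        tprod_coeFn f g, h] with z h1 h2 h3 h5
      simp only [Function.comp_apply, Pi.smul_apply] at h5
      rw [h1, h2, Pi.smul_apply, h3, h5, mul_smul_comm])

/-- The canonical embedding of the algebraic tensor product into `L²(ℝ²)`. -/
def tensorEmb : (H ⊗[ℂ] H) →ₗ[ℂ] H₂ := TensorProduct.lift tprodₗ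

/-- The tensor product `S ⊗ T` of bounded operators: the continuous extension to `L²(ℝ²)` of
`f ⊗ g ↦ S f ⊗ T g`. -/
def tensorOp (S T : H →L[ℂ] H) : H₂ →L[ℂ] H₂ :=
  LinearMap.extendOfNorm
    (tensorEmb ∘ₗ TensorProduct.map (S : H →ₗ[ℂ] H) (T : H →ₗ[ℂ] H)) tensorEmb

theorem inner_tprod (f g f' g' : H) : ⟪tprod f g, tprod f' g'⟫_ℂ = ⟪f, f'⟫_ℂ * ⟪g, g'⟫_ℂ := by
  rw [L2.inner_def, L2.inner_def, L2.inner_def, ← integral_prod_mul, ← Measure.volume_eq_prod]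
  refine integral_congr_ae ?_
  filter_upwards [tprod_coeFn f g, tprod_coeFn f' g'] with z h1 h2
  rw [h1, h2]
  simp only [RCLike.inner_apply, map_mul]
  ring

theorem inner_tensorEmb (x y : H ⊗[ℂ] H) : ⟪tensorEmb x, tensorEmb y⟫_ℂ = ⟪x, y⟫_ℂ := by
  induction x with
  | zero => simp
  | add a b ha hb => rw [map_add, inner_add_left, inner_add_left, ha, hb]
  | tmul f g =>
    induction y with
    | zero => simp
    | add a b ha hb => rw [map_add, inner_add_right, inner_add_right, ha, hb]
    | tmul f' g' => exact inner_tprod f g f' g'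

theorem norm_tensorEmb (x : H ⊗[ℂ] H) : ‖tensorEmb x‖ = ‖x‖ := by
  rw [norm_eq_sqrt_re_inner (𝕜 := ℂ), norm_eq_sqrt_re_inner (𝕜 := ℂ), inner_tensorEmb]

section Bound

variable {K : Type*} [NormedAddCommGroup K] [InnerProductSpace ℂ K] [CompleteSpace K]

theorem inner_tmap (S T : K →L[ℂ] K) (x y : K ⊗[ℂ] K) :
    ⟪TensorProduct.map (S : K →ₗ[ℂ] K) (T : K →ₗ[ℂ] K) x, y⟫_ℂ =
      ⟪x, TensorProduct.map ((ContinuousLinearMap.adjoint S : K →L[ℂ] K) : K →ₗ[ℂ] K)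
        ((ContinuousLinearMap.adjoint T : K →L[ℂ] K) : K →ₗ[ℂ] K) y⟫_ℂ := by
  induction x with
  | zero => simp
  | add a b ha hb => rw [map_add, inner_add_left, inner_add_left, ha, hb]
  | tmul f g =>
    induction y with
    | zero => simp
    | add a b ha hb => rw [map_add, inner_add_right, inner_add_right, ha, hb]
    | tmul f' g' => simp [ContinuousLinearMap.adjoint_inner_right]

theorem exists_star_mul_self_add (S : K →L[ℂ] K) :
    ∃ R : K →L[ℂ] K, star S * S + star R * R = ((‖S‖ ^ 2 : ℝ) : ℂ) • (1 : K →L[ℂ] K) := by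
  have h1 : (0 : K →L[ℂ] K) ≤ algebraMap ℝ _ (‖S‖ ^ 2) - star S * S :=
    sub_nonneg.2 CStarAlgebra.star_mul_le_algebraMap_norm_sq
  obtain ⟨R, hR⟩ := CStarAlgebra.nonneg_iff_eq_star_mul_self.1 h1
  refine ⟨R, ?_⟩
  rw [← hR, Algebra.algebraMap_eq_smul_one, add_sub_cancel]
  ext x
  rw [smul_apply, smul_apply, Complex.coe_smul]

theorem norm_tmap_left (S : K →L[ℂ] K) (x : K ⊗[ℂ] K) :
    ‖TensorProduct.map (S : K →ₗ[ℂ] K) LinearMap.id x‖ ≤ ‖S‖ * ‖x‖ := by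
  obtain ⟨R, h3⟩ := exists_star_mul_self_add S
  have key : ∀ A : K →L[ℂ] K, (‖TensorProduct.map (A : K →ₗ[ℂ] K) LinearMap.id x‖ : ℂ) ^ 2 =
      ⟪x, TensorProduct.map ((star A * A : K →L[ℂ] K) : K →ₗ[ℂ] K) LinearMap.id x⟫_ℂ := by
    intro A
    have h := inner_self_eq_norm_sq_to_K (𝕜 := ℂ)
      (TensorProduct.map (A : K →ₗ[ℂ] K) LinearMap.id x)
    have h2 := inner_tmap A 1 x (TensorProduct.map (A : K →ₗ[ℂ] K) LinearMap.id x)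
    rw [← ContinuousLinearMap.star_eq_adjoint, ← ContinuousLinearMap.star_eq_adjoint, star_one,
      ← LinearMap.comp_apply, ← TensorProduct.map_comp] at h2
    exact h.symm.trans h2
  have h4 : (‖TensorProduct.map (S : K →ₗ[ℂ] K) LinearMap.id x‖ : ℂ) ^ 2 +
      (‖TensorProduct.map (R : K →ₗ[ℂ] K) LinearMap.id x‖ : ℂ) ^ 2 =
        ((‖S‖ ^ 2 : ℝ) : ℂ) * (‖x‖ : ℂ) ^ 2 := by
    rw [key S, key R]
    refine (inner_add_right (𝕜 := ℂ) x _ _).symm.trans ?_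
    rw [← LinearMap.add_apply, ← TensorProduct.map_add_left,
      ← ContinuousLinearMap.toLinearMap_add, h3, ContinuousLinearMap.toLinearMap_smul,
      TensorProduct.map_smul_left, LinearMap.smul_apply, inner_smul_right]
    congr 1
    have : TensorProduct.map ((1 : K →L[ℂ] K) : K →ₗ[ℂ] K) (LinearMap.id : K →ₗ[ℂ] K) x = x :=
      LinearMap.congr_fun TensorProduct.map_id x
    rw [this]
    exact inner_self_eq_norm_sq_to_K x
  have h5 : ‖TensorProduct.map (S : K →ₗ[ℂ] K) LinearMap.id x‖ ^ 2 +
      ‖TensorProduct.map (R : K →ₗ[ℂ] K) LinearMap.id x‖ ^ 2 = ‖S‖ ^ 2 * ‖x‖ ^ 2 := by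
    exact_mod_cast h4
  refine le_of_sq_le_sq ?_ (by positivity)
  rw [mul_pow]
  nlinarith [sq_nonneg ‖TensorProduct.map (R : K →ₗ[ℂ] K) LinearMap.id x‖]

theorem norm_tmap (S T : K →L[ℂ] K) (x : K ⊗[ℂ] K) :
    ‖TensorProduct.map (S : K →ₗ[ℂ] K) (T : K →ₗ[ℂ] K) x‖ ≤ ‖S‖ * ‖T‖ * ‖x‖ := by
  have h1 : TensorProduct.map (S : K →ₗ[ℂ] K) (T : K →ₗ[ℂ] K) x =
      TensorProduct.map (S : K →ₗ[ℂ] K) LinearMap.id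
        (TensorProduct.comm ℂ K K (TensorProduct.map (T : K →ₗ[ℂ] K) LinearMap.id
          (TensorProduct.comm ℂ K K x))) := by
    induction x with
    | zero => simp
    | add a b ha hb => simp only [map_add, ha, hb]
    | tmul f g => simp
  rw [h1]
  refine (norm_tmap_left S _).trans ?_
  rw [TensorProduct.norm_comm, mul_assoc]
  refine mul_le_mul_of_nonneg_left ((norm_tmap_left T _).trans ?_) (norm_nonneg _)
  rw [TensorProduct.norm_comm]

end Bound

theorem denseRange_tensorEmb : DenseRange tensorEmb := by
  have : (LinearMap.range tensorEmb).topologicalClosure = ⊤ := by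
    rw [Submodule.topologicalClosure_eq_top_iff, Submodule.eq_bot_iff]
    intro Φ hΦ
    rw [Submodule.mem_orthogonal] at hΦ
    set I : ℕ → Set ℝ := fun n => Set.Icc (-(n : ℝ)) n with hI
    have hIm : ∀ n, MeasurableSet (I n) := fun n => measurableSet_Icc
    have hfin : ∀ n, (volume : Measure (ℝ × ℝ)) (I n ×ˢ I n) < ∞ := fun n =>
      (isCompact_Icc.prod isCompact_Icc).measure_lt_top
    have hint : ∀ n, Integrable Φ (volume.restrict (I n ×ˢ I n)) := fun n => by
      have : IsFiniteMeasure ((volume : Measure (ℝ × ℝ)).restrict (I n ×ˢ I n)) :=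
        ⟨by simpa using hfin n⟩
      exact ((Lp.memLp Φ).restrict _).integrable (by norm_num)
    have hrect : ∀ A B : Set ℝ, MeasurableSet A → MeasurableSet B → ∀ n,
        ∫ u in (A ∩ I n) ×ˢ (B ∩ I n), Φ u = 0 := by
      intro A B hA hB n
      have hAf : (volume : Measure ℝ) (A ∩ I n) ≠ ∞ :=
        ((measure_mono Set.inter_subset_right).trans_lt isCompact_Icc.measure_lt_top).ne
      have hBf : (volume : Measure ℝ) (B ∩ I n) ≠ ∞ :=
        ((measure_mono Set.inter_subset_right).trans_lt isCompact_Icc.measure_lt_top).ne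
      have hAm := hA.inter (hIm n)
      have hBm := hB.inter (hIm n)
      have h := hΦ (tprod (indicatorConstLp 2 hAm hAf (1 : ℂ)) (indicatorConstLp 2 hBm hBf (1 : ℂ)))
        ⟨_ ⊗ₜ _, rfl⟩
      rw [← h, L2.inner_def, ← integral_indicator (hAm.prod hBm)]
      refine integral_congr_ae ?_
      have h1 := (Measure.quasiMeasurePreserving_fst (μ := (volume : Measure ℝ))
        (ν := (volume : Measure ℝ))).ae_eq_comp
        (indicatorConstLp_coeFn (p := 2) (hs := hAm) (hμs := hAf) (c := (1 : ℂ)))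
      have h2 := (Measure.quasiMeasurePreserving_snd (μ := (volume : Measure ℝ))
        (ν := (volume : Measure ℝ))).ae_eq_comp
        (indicatorConstLp_coeFn (p := 2) (hs := hBm) (hμs := hBf) (c := (1 : ℂ)))
      filter_upwards [tprod_coeFn (indicatorConstLp 2 hAm hAf (1 : ℂ))
        (indicatorConstLp 2 hBm hBf (1 : ℂ)), h1, h2] with u h3 h4 h5
      simp only [Function.comp_apply] at h4 h5
      rw [h3, h4, h5]
      by_cases ha : u.1 ∈ A ∩ I n <;> by_cases hb : u.2 ∈ B ∩ I n <;>
        simp [Set.indicator, Set.mem_prod, ha, hb, -Set.mem_inter_iff]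
    have hall : ∀ n, ∀ s : Set (ℝ × ℝ), MeasurableSet s →
        ∫ u in s, Φ u ∂(volume.restrict (I n ×ˢ I n)) = 0 := by
      intro n s hs
      have huniv : ∫ u, Φ u ∂(volume.restrict (I n ×ˢ I n)) = 0 := by
        simpa using hrect Set.univ Set.univ MeasurableSet.univ MeasurableSet.univ n
      induction s, hs using MeasurableSpace.induction_on_inter generateFrom_prod.symm
        isPiSystem_prod with
      | empty => simp
      | basic s hs =>
        obtain ⟨A, hA, B, hB, rfl⟩ := hs
        have hA' : MeasurableSet A := hA
        have hB' : MeasurableSet B := hB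
        rw [Measure.restrict_restrict (hA'.prod hB'), Set.prod_inter_prod]
        exact hrect A B hA' hB' n
      | compl s hs ih => rw [setIntegral_compl hs (hint n), ih, huniv, sub_zero]
      | iUnion f hd hm ih =>
        rw [integral_iUnion hm hd (hint n).integrableOn]
        simp [ih]
    have hz : ∀ n, ∀ᵐ u ∂((volume : Measure (ℝ × ℝ)).restrict (I n ×ˢ I n)), Φ u = 0 := fun n =>
      (hint n).ae_eq_zero_of_forall_setIntegral_eq_zero fun s hs _ => hall n s hs
    have hU : (⋃ n, I n ×ˢ I n) = Set.univ := by
      refine Set.eq_univ_of_forall fun u => ?_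
      obtain ⟨n, hn⟩ := exists_nat_ge (max |u.1| |u.2|)
      exact Set.mem_iUnion.2 ⟨n, abs_le.1 ((le_max_left _ _).trans hn),
        abs_le.1 ((le_max_right _ _).trans hn)⟩
    have hz' := (ae_restrict_iUnion_iff (fun n => I n ×ˢ I n) (fun u => Φ u = 0)).2 hz
    rw [hU, Measure.restrict_univ] at hz'
    ext1
    exact Filter.EventuallyEq.trans hz' (Lp.coeFn_zero _ _ _).symm
  exact (Submodule.dense_iff_topologicalClosure_eq_top.2 this)

/-- `(S ⊗ T)(f ⊗ g) = S f ⊗ T g`. -/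
theorem tensorOp_tprod (S T : H →L[ℂ] H) (f g : H) :
    tensorOp S T (tprod f g) = tprod (S f) (T g) :=
  LinearMap.extendOfNorm_eq denseRange_tensorEmb
    ⟨‖S‖ * ‖T‖, fun x => by
      rw [norm_tensorEmb, LinearMap.comp_apply, norm_tensorEmb]
      exact norm_tmap S T x⟩ (f ⊗ₜ g)

/-! ### Trace, states, observables -/

section General

variable {K : Type*} [NormedAddCommGroup K] [InnerProductSpace ℂ K]

section Trace

variable [CompleteSpace K]

variable (K) in
/-- A fixed orthonormal (Hilbert) basis of `K`. -/
def onb : HilbertBasis (exists_hilbertBasis ℂ K).choose ℂ K :=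
  (exists_hilbertBasis ℂ K).choose_spec.choose

/-- The trace `∑ᵢ ⟨eᵢ, T eᵢ⟩`; for trace class operators it does not depend on the basis. -/
def tr (T : K →L[ℂ] K) : ℂ := ∑' i, ⟪onb K i, T (onb K i)⟫_ℂ

/-- States are positive operators of trace one. -/
structure IsState (ρ : K →L[ℂ] K) : Prop where
  isPositive : ρ.IsPositive
  hasSum_one : HasSum (fun i => ⟪onb K i, ρ (onb K i)⟫_ℂ) 1

end Trace

variable (K) in
/-- An observable with outcome space `α`: a normalized positive operator measure, i.e. a map from
measurable sets to positive operators, weakly `σ`-additive, with `E(α) = I`. (The irrelevant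
values on non-measurable sets are set to `0`.) -/
@[ext]
structure Observable (α : Type*) [MeasurableSpace α] where
  /-- The effect of a set of outcomes. -/
  effect : Set α → K →L[ℂ] K
  effect_of_not_measurableSet : ∀ A, ¬ MeasurableSet A → effect A = 0
  isPositive : ∀ A, MeasurableSet A → (effect A).IsPositive
  effect_univ : effect Set.univ = 1
  hasSum_inner : ∀ A : ℕ → Set α, (∀ n, MeasurableSet (A n)) →
    Pairwise (fun m n => Disjoint (A m) (A n)) → ∀ φ ψ : K,
      HasSum (fun n => ⟪φ, effect (A n) ψ⟫_ℂ) ⟪φ, effect (⋃ n, A n) ψ⟫_ℂ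

namespace Observable

variable {α : Type*} [MeasurableSpace α]

/-- The measure `A ↦ ⟨ψ, E(A) ψ⟩`. -/
def measure (E : Observable K α) (ψ : K) : Measure α :=
  Measure.ofMeasurable (fun A _ => ENNReal.ofReal (⟪ψ, E.effect A ψ⟫_ℂ).re)
    (by
      have h := E.hasSum_inner (fun _ => ∅) (fun _ => MeasurableSet.empty)
        (fun _ _ _ => disjoint_bot_left) ψ ψ
      have h0 : ⟪ψ, E.effect ∅ ψ⟫_ℂ = 0 :=
        tendsto_nhds_unique tendsto_const_nhds h.summable.tendsto_atTop_zero
      simp [h0])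
    (fun A hA hd => by
      have h := Complex.hasSum_re (E.hasSum_inner A hA hd ψ ψ)
      rw [← h.tsum_eq, ENNReal.ofReal_tsum_of_nonneg _ h.summable]
      intro n
      simpa using (E.isPositive (A n) (hA n)).re_inner_nonneg_right ψ)

theorem measure_apply (E : Observable K α) (ψ : K) {A : Set α} (hA : MeasurableSet A) :
    E.measure ψ A = ENNReal.ofReal (⟪ψ, E.effect A ψ⟫_ℂ).re :=
  Measure.ofMeasurable_apply A hA

/-- Projection valued observables. -/
def IsProjectionValued (E : Observable K α) : Prop :=
  ∀ A, MeasurableSet A → IsIdempotentElem (E.effect A)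

/-- `E` is the spectral measure of the (unbounded) operator `T`, i.e. `T = ∫ x dE(x)`: `E` is
projection valued, the domain of `T` consists of the `ψ` with `∫ x² d⟨ψ, E ψ⟩ < ∞`, and
`⟨ψ, T ψ⟩ = ∫ x d⟨ψ, E ψ⟩` on it. -/
structure IsSpectralMeasure (E : Observable K ℝ) (T : K →ₗ.[ℂ] K) : Prop where
  isProjectionValued : E.IsProjectionValued
  mem_domain_iff : ∀ ψ, ψ ∈ T.domain ↔ Integrable (fun x : ℝ => x ^ 2) (E.measure ψ)
  inner_eq : ∀ ψ : T.domain, ⟪(ψ : K), T ψ⟫_ℂ = ((∫ x : ℝ, x ∂(E.measure (ψ : K)) : ℝ) : ℂ)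

end Observable

end General

/-! ### Quadratures -/

/-- Multiplication by the coordinate on Schwartz functions. -/
def posS : 𝓢(ℝ, ℂ) →L[ℂ] 𝓢(ℝ, ℂ) := SchwartzMap.smulLeftCLM ℂ (fun x : ℝ => (x : ℂ))

theorem posS_apply (f : 𝓢(ℝ, ℂ)) (x : ℝ) : posS f x = x * f x := by
  have h : (fun x : ℝ => (x : ℂ)).HasTemperateGrowth :=
    Complex.ofRealCLM.hasTemperateGrowth
  simp [posS, h]

/-- The annihilation operator `a = (x + d/dx)/√2` on Schwartz functions. -/
def annihilation : 𝓢(ℝ, ℂ) →L[ℂ] 𝓢(ℝ, ℂ) :=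
  ((Real.sqrt 2 : ℂ)⁻¹) • (posS + SchwartzMap.derivCLM ℂ ℂ)

/-- The creation operator `a* = (x - d/dx)/√2` on Schwartz functions. -/
def creation : 𝓢(ℝ, ℂ) →L[ℂ] 𝓢(ℝ, ℂ) :=
  ((Real.sqrt 2 : ℂ)⁻¹) • (posS - SchwartzMap.derivCLM ℂ ℂ)

/-- `(e^{iθ} a* + e^{-iθ} a)/√2` on Schwartz functions. -/
def quadratureS (θ : ℝ) : 𝓢(ℝ, ℂ) →L[ℂ] 𝓢(ℝ, ℂ) :=
  ((Real.sqrt 2 : ℂ)⁻¹) • (Complex.exp (Complex.I * θ) • creation +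
    Complex.exp (-(Complex.I * θ)) • annihilation)

/-- The embedding of Schwartz functions into `L²(ℝ)`. -/
def schwartzEmb : 𝓢(ℝ, ℂ) →ₗ[ℂ] H :=
  (SchwartzMap.toLpCLM ℂ ℂ 2 (volume : Measure ℝ) : 𝓢(ℝ, ℂ) →ₗ[ℂ] H)

theorem schwartzEmb_injective : Function.Injective schwartzEmb :=
  SchwartzMap.injective_toLp 2 (volume : Measure ℝ)

/-- The quadrature operator `Q_θ`: the closure in `L²(ℝ)` of `(e^{iθ} a* + e^{-iθ} a)/√2`. -/
def quadrature (θ : ℝ) : H →ₗ.[ℂ] H :=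
  LinearPMap.closure
    { domain := LinearMap.range schwartzEmb
      toFun := schwartzEmb ∘ₗ (quadratureS θ : 𝓢(ℝ, ℂ) →ₗ[ℂ] 𝓢(ℝ, ℂ)) ∘ₗ
        (LinearEquiv.ofInjective schwartzEmb schwartzEmb_injective).symm.toLinearMap }

/-! ### Weyl operators -/

/-- The operator `e^{-iqP}`: the translation `(e^{-iqP} ψ)(x) = ψ(x - q)`. -/
def translation (q : ℝ) : H →L[ℂ] H :=
  (Lp.compMeasurePreservingₗᵢ ℂ (fun x : ℝ => x - q)
    (measurePreserving_sub_right volume q)).toContinuousLinearMap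

theorem memLp_modulation (p : ℝ) (f : H) :
    MemLp (fun x : ℝ => Complex.exp (Complex.I * (p * x)) * f x) 2 (volume : Measure ℝ) := by
  refine (Lp.memLp f).of_le ?_ (Filter.Eventually.of_forall fun x => ?_)
  · exact (by fun_prop : Continuous fun x : ℝ =>
      Complex.exp (Complex.I * (p * x))).aestronglyMeasurable.mul (Lp.aestronglyMeasurable f)
  · rw [norm_mul, mul_comm Complex.I, ← Complex.ofReal_mul, Complex.norm_exp_ofReal_mul_I, one_mul]

/-- The operator `e^{ipQ}`: multiplication by the function `x ↦ e^{ipx}`. -/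
def modulation (p : ℝ) : H →L[ℂ] H :=
  LinearMap.mkContinuous
    { toFun := fun f => (memLp_modulation p f).toLp _
      map_add' := fun f g => by
        ext1
        filter_upwards [(memLp_modulation p (f + g)).coeFn_toLp, Lp.coeFn_add f g,
          Lp.coeFn_add ((memLp_modulation p f).toLp _) ((memLp_modulation p g).toLp _),
          (memLp_modulation p f).coeFn_toLp, (memLp_modulation p g).coeFn_toLp]
          with x h1 h2 h3 h4 h5
        rw [h1, h3, Pi.add_apply, h4, h5, h2, Pi.add_apply, mul_add]
      map_smul' := fun c f => by
        ext1
        filter_upwards [(memLp_modulation p (c • f)).coeFn_toLp, Lp.coeFn_smul c f,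
          Lp.coeFn_smul c ((memLp_modulation p f).toLp _),
          (memLp_modulation p f).coeFn_toLp] with x h1 h2 h3 h4
        rw [h1, RingHom.id_apply, h3, Pi.smul_apply, h4, h2, Pi.smul_apply, mul_smul_comm] }
    1 (fun f => by
      rw [one_mul]
      refine Lp.norm_le_norm_of_ae_le ?_
      filter_upwards [(memLp_modulation p f).coeFn_toLp] with x h
      simp only [LinearMap.coe_mk, AddHom.coe_mk]
      rw [h, norm_mul, mul_comm Complex.I, ← Complex.ofReal_mul, Complex.norm_exp_ofReal_mul_I,
        one_mul])

/-- The Weyl operator `W(q, p) = e^{iqp/2} e^{-iqP} e^{ipQ}`. -/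
def weyl (q p : ℝ) : H →L[ℂ] H :=
  Complex.exp (Complex.I * (q * p / 2)) • (translation q ∘L modulation p)

/-! ### The beam splitter -/

/-- The linear map `(x, y) ↦ ((x + y)/√2, (-x + y)/√2)`. -/
def rot : ℝ × ℝ →ₗ[ℝ] ℝ × ℝ :=
  (Real.sqrt 2)⁻¹ • LinearMap.prod (LinearMap.fst ℝ ℝ ℝ + LinearMap.snd ℝ ℝ ℝ)
    (-LinearMap.fst ℝ ℝ ℝ + LinearMap.snd ℝ ℝ ℝ)

theorem rot_apply (x y : ℝ) :
    rot (x, y) = ((Real.sqrt 2)⁻¹ * (x + y), (Real.sqrt 2)⁻¹ * (-x + y)) := rfl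

theorem det_rot : LinearMap.det rot = 1 := by
  rw [← LinearMap.det_toMatrix (Module.Basis.finTwoProd ℝ), Matrix.det_fin_two]
  simp only [LinearMap.toMatrix_apply, Module.Basis.finTwoProd_zero,
    Module.Basis.finTwoProd_one, rot_apply, Module.Basis.coe_finTwoProd_repr]
  have h : Real.sqrt 2 * Real.sqrt 2 = 2 := Real.mul_self_sqrt (by norm_num)
  have h' : Real.sqrt 2 ≠ 0 := by positivity
  simp
  field_simp
  nlinarith

theorem measurePreserving_rot :
    MeasurePreserving rot (volume : Measure (ℝ × ℝ)) (volume : Measure (ℝ × ℝ)) := by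
  refine ⟨rot.continuous_of_finiteDimensional.measurable, ?_⟩
  have h := Measure.map_linearMap_addHaar_eq_smul_addHaar (volume : Measure (ℝ × ℝ))
    (f := rot) (by rw [det_rot]; exact one_ne_zero)
  simpa [det_rot] using h

/-- The 50:50 beam splitter in the coordinate representation,
`(U Ψ)(x, y) = Ψ((x + y)/√2, (-x + y)/√2)`. -/
def beamSplitter : H₂ →L[ℂ] H₂ :=
  (Lp.compMeasurePreservingₗᵢ ℂ rot measurePreserving_rot).toContinuousLinearMap

/-- The wave function
`π^{-1/4} exp(-x²/2 + √2 z x - z²/2 - |z|²/2)` of the coherent state `|z⟩`. -/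
def coherentFun (z : ℂ) (x : ℝ) : ℂ :=
  ((Real.pi ^ (-(1 / 4) : ℝ) : ℝ) : ℂ) *
    Complex.exp (-(x : ℂ) ^ 2 / 2 + Real.sqrt 2 * z * x - z ^ 2 / 2 - (‖z‖ : ℂ) ^ 2 / 2)

theorem memLp_coherentFun (z : ℂ) : MemLp (coherentFun z) 2 (volume : Measure ℝ) := by
  have hc : Continuous (coherentFun z) := by unfold coherentFun; fun_prop
  rw [memLp_two_iff_integrable_sq_norm hc.aestronglyMeasurable]
  have h := ((integrable_exp_neg_mul_sq one_pos).comp_sub_right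
    (Real.sqrt 2 * z.re)).const_mul ((Real.pi ^ (-(1 / 4) : ℝ)) ^ 2)
  refine h.congr (Filter.Eventually.of_forall fun x => ?_)
  have hs : Real.sqrt 2 ^ 2 = 2 := Real.sq_sqrt (by norm_num)
  have hn : ‖z‖ ^ 2 = z.re ^ 2 + z.im ^ 2 := by
    rw [Complex.sq_norm, Complex.normSq_apply]; ring
  have hre : (-(x : ℂ) ^ 2 / 2 + Real.sqrt 2 * z * x - z ^ 2 / 2 - (‖z‖ : ℂ) ^ 2 / 2).re =
      -(x - Real.sqrt 2 * z.re) ^ 2 / 2 := by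
    rw [← Complex.ofReal_pow ‖z‖, hn]
    simp [pow_two]
    nlinarith
  simp only [coherentFun, norm_mul, Complex.norm_exp, hre, mul_pow, Complex.norm_real,
    Real.norm_eq_abs, sq_abs]
  rw [← Real.exp_nat_mul]
  congr 2
  push_cast
  ring

/-- The coherent state `|z⟩`. -/
def coherent (z : ℂ) : H := (memLp_coherentFun z).toLp _

/-- The beam splitter is the unitary operator that acts on coherent states by
`|z⟩ ⊗ |w⟩ ↦ |(z - w)/√2⟩ ⊗ |(z + w)/√2⟩`. -/
theorem beamSplitter_coherent (z w : ℂ) :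
    beamSplitter (tprod (coherent z) (coherent w)) =
      tprod (coherent ((Real.sqrt 2 : ℂ)⁻¹ * (z - w))) (coherent ((Real.sqrt 2 : ℂ)⁻¹ * (z + w))) := by
  have hcoh : ∀ z w : ℂ, tprod (coherent z) (coherent w) =ᵐ[(volume : Measure (ℝ × ℝ))]
      fun u => coherentFun z u.1 * coherentFun w u.2 := by
    intro z w
    have h1 := (Measure.quasiMeasurePreserving_fst (μ := (volume : Measure ℝ))
        (ν := (volume : Measure ℝ))).ae_eq_comp (memLp_coherentFun z).coeFn_toLp
    have h2 := (Measure.quasiMeasurePreserving_snd (μ := (volume : Measure ℝ))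
        (ν := (volume : Measure ℝ))).ae_eq_comp (memLp_coherentFun w).coeFn_toLp
    filter_upwards [tprod_coeFn (coherent z) (coherent w), h1, h2] with u h h1 h2
    simp only [Function.comp_apply] at h1 h2
    rw [h]
    exact congrArg₂ _ h1 h2
  ext1
  filter_upwards [Lp.coeFn_compMeasurePreserving (tprod (coherent z) (coherent w))
      measurePreserving_rot, measurePreserving_rot.quasiMeasurePreserving.ae_eq_comp (hcoh z w),
    hcoh ((Real.sqrt 2 : ℂ)⁻¹ * (z - w)) ((Real.sqrt 2 : ℂ)⁻¹ * (z + w))] with u h1 h2 h3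
  refine h1.trans (h2.trans (Eq.trans ?_ h3.symm))
  obtain ⟨x, y⟩ := u
  have hs : (Real.sqrt 2 : ℂ) ^ 2 = 2 := by
    rw [← Complex.ofReal_pow, Real.sq_sqrt (by norm_num)]; norm_num
  have hs0 : (Real.sqrt 2 : ℂ) ≠ 0 := by
    intro h; rw [h] at hs; norm_num at hs
  have hn : ∀ z : ℂ, (‖z‖ : ℂ) ^ 2 = z * (starRingEnd ℂ) z := fun z =>
    (Complex.mul_conj' z).symm
  simp only [Function.comp_apply, rot_apply, coherentFun]
  rw [mul_mul_mul_comm, ← Complex.exp_add, mul_mul_mul_comm, ← Complex.exp_add]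
  congr 2
  simp only [hn, map_mul, map_sub, map_add, map_inv₀, Complex.conj_ofReal, Complex.ofReal_mul,
    Complex.ofReal_add, Complex.ofReal_neg, Complex.ofReal_inv]
  field_simp
  rw [hs]
  ring

/-! ### The measured observable -/

/-- `E` is the signal observable measured in the high-amplitude limit with phase shift `θ` and
parameter field `σ`: for all states `ρ` and all Borel sets `X`, `Y`,
`tr[ρ E(X × Y)] = tr[U (ρ ⊗ σ) U* (𝖰(X/√2) ⊗ 𝖰_θ(Y/√2))]`,
where `𝖰` and `𝖰_θ` are the spectral measures of `Q_0` and `Q_θ`. -/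
def IsHighAmplitudeObservable (θ : ℝ) (σ : H →L[ℂ] H) (E : Observable H (ℝ × ℝ)) : Prop :=
  ∃ Q Qθ : Observable H ℝ, Q.IsSpectralMeasure (quadrature 0) ∧
    Qθ.IsSpectralMeasure (quadrature θ) ∧
    ∀ ρ : H →L[ℂ] H, IsState ρ → ∀ X Y : Set ℝ, MeasurableSet X → MeasurableSet Y →
      tr (ρ ∘L E.effect (X ×ˢ Y)) =
        tr ((beamSplitter ∘L tensorOp ρ σ ∘L ContinuousLinearMap.adjoint beamSplitter) ∘L
          tensorOp (Q.effect ((fun x => x / Real.sqrt 2) '' X))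
            (Qθ.effect ((fun y => y / Real.sqrt 2) '' Y)))

/-- Covariance under the Weyl representation: `W(q, p) E(Z) W(q, p)* = E(Z + (q, p))`. -/
def IsCovariant (E : Observable H (ℝ × ℝ)) : Prop :=
  ∀ (q p : ℝ) (Z : Set (ℝ × ℝ)), MeasurableSet Z →
    weyl q p ∘L E.effect Z ∘L ContinuousLinearMap.adjoint (weyl q p) =
      E.effect ((fun z => z + (q, p)) '' Z)

end EightPort

end

/-!
A spectral measure is determined by its operator: on the range of `E [m - r, m + r]` the powers of
the operator minus `m` grow at most like `rⁿ`, and on the range of `F [m + c, ∞)` at least like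
`cⁿ`, so for `r < c` these two ranges are orthogonal. Hence a unitary that shifts the quadrature
shifts its spectral measure.

Let `G` be the joint spectral measure of `Q₀` and `Q_θ` on the two outputs of the beam splitter `U`,
with the outcomes scaled by `√2`. Compressing `G` by the maps `φ ↦ U (φ ⊗ √σ eₖ)` and summing over
an orthonormal basis `(eₖ)` gives the observable; rank-one states and rectangles show that it is the
only one. The beam splitter turns `W(q, p) ⊗ 1` into `w ⊗ w` with `w = W(q/√2, p/√2)`, which shifts
`Q₀` by `q/√2` and `Q_θ` by `(q cos θ + p sin θ)/√2`.

If the observable is moreover covariant, then comparing the two shifts for `(q, p) = (0, 1)` makes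
it invariant under the translation by `(0, 1 - sin θ)`. By Poincaré recurrence a nonzero finite
measure is invariant under no nonzero translation, so `sin θ = 1`.
-/

noncomputable section

namespace EightPort

open ContinuousLinearMap (adjoint)

/-! ### Operations on observables -/

section MeasureSum

variable {α ι : Type*} [MeasurableSpace α]

theorem hasSum_measureReal_iUnion (μ : Measure α) [IsFiniteMeasure μ] {A : ℕ → Set α}
    (hA : ∀ n, MeasurableSet (A n)) (hd : Pairwise fun m n => Disjoint (A m) (A n)) :
    HasSum (fun n => μ.real (A n)) (μ.real (⋃ n, A n)) := by
  simpa only [Measure.toSignedMeasure_apply_measurable (hA _),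
    Measure.toSignedMeasure_apply_measurable (MeasurableSet.iUnion hA)]
    using μ.toSignedMeasure.m_iUnion hA hd

variable {μ : ι → Measure α} [∀ k, IsFiniteMeasure (μ k)]

theorem tsum_measure_lt_top (hμ : Summable fun k => (μ k).real Set.univ) (A : Set α) :
    ∑' k, μ k A < ∞ := by
  have hreal : ∑' k, ENNReal.ofReal ((μ k).real Set.univ) < ∞ := hμ.tsum_ofReal_lt_top
  simp only [ofReal_measureReal (measure_ne_top _ _)] at hreal
  exact (ENNReal.tsum_le_tsum fun k => measure_mono (Set.subset_univ A)).trans_lt hreal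

theorem isFiniteMeasure_sum (hμ : Summable fun k => (μ k).real Set.univ) :
    IsFiniteMeasure (Measure.sum μ) :=
  ⟨by simpa only [Measure.sum_apply _ MeasurableSet.univ] using tsum_measure_lt_top hμ Set.univ⟩

theorem hasSum_measureReal_sum (hμ : Summable fun k => (μ k).real Set.univ) {A : Set α}
    (hA : MeasurableSet A) : HasSum (fun k => (μ k).real A) ((Measure.sum μ).real A) := by
  have hfin := (tsum_measure_lt_top hμ A).ne
  rw [Measure.real, Measure.sum_apply _ hA,
    ENNReal.tsum_toReal_eq fun k => ENNReal.ne_top_of_tsum_ne_top hfin k]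
  exact ENNReal.hasSum_toReal hfin

end MeasureSum

section Operations

variable {K L : Type*} [NormedAddCommGroup K] [InnerProductSpace ℂ K]
  [NormedAddCommGroup L] [InnerProductSpace ℂ L]
  {α β : Type*} [MeasurableSpace α] [MeasurableSpace β]

theorem clm_ext_inner_self {S T : K →L[ℂ] K} (h : ∀ x, ⟪x, S x⟫_ℂ = ⟪x, T x⟫_ℂ) : S = T := by
  refine ContinuousLinearMap.coe_injective ((ext_inner_map _ _).1 fun x => ?_)
  simpa only [inner_conj_symm, ContinuousLinearMap.coe_coe] using congrArg (starRingEnd ℂ) (h x)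

namespace Observable

theorem inner_effect_comm (E : Observable K α) (A : Set α) (φ ψ : K) :
    ⟪φ, E.effect A ψ⟫_ℂ = ⟪E.effect A φ, ψ⟫_ℂ := by
  by_cases hA : MeasurableSet A
  · exact ((E.isPositive A hA).isSymmetric φ ψ).symm
  · simp [E.effect_of_not_measurableSet A hA]

theorem measure_univ (E : Observable K α) (ψ : K) :
    E.measure ψ Set.univ = ENNReal.ofReal (‖ψ‖ ^ 2) := by
  rw [measure_apply _ _ MeasurableSet.univ, effect_univ, one_apply_eq_self,
    inner_self_eq_norm_sq_to_K]
  norm_cast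

instance (E : Observable K α) (ψ : K) : IsFiniteMeasure (E.measure ψ) :=
  ⟨by rw [measure_univ]; exact ENNReal.ofReal_lt_top⟩

theorem measureReal_univ (E : Observable K α) (ψ : K) :
    (E.measure ψ).real Set.univ = ‖ψ‖ ^ 2 := by
  rw [Measure.real, measure_univ, ENNReal.toReal_ofReal (by positivity)]

theorem inner_effect_self (E : Observable K α) (ψ : K) {A : Set α} (hA : MeasurableSet A) :
    ⟪ψ, E.effect A ψ⟫_ℂ = ((E.measure ψ).real A : ℂ) := by
  obtain ⟨hre, him⟩ := Complex.nonneg_iff.1 ((E.isPositive A hA).inner_nonneg_right ψ)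
  rw [Measure.real, measure_apply _ _ hA, ENNReal.toReal_ofReal hre]
  exact Complex.ext rfl (by simpa using him.symm)

theorem ext_of_measure {E F : Observable K α} (h : ∀ ψ, E.measure ψ = F.measure ψ) : E = F := by
  refine Observable.ext (funext fun A => ?_)
  by_cases hA : MeasurableSet A
  · exact clm_ext_inner_self fun ψ => by
      rw [inner_effect_self _ _ hA, inner_effect_self _ _ hA, h]
  · rw [E.effect_of_not_measurableSet A hA, F.effect_of_not_measurableSet A hA]

theorem ext_of_generateFrom {E F : Observable K α} (C : Set (Set α))
    (hgen : ‹MeasurableSpace α› = MeasurableSpace.generateFrom C) (hpi : IsPiSystem C)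
    (h : ∀ A ∈ C, E.effect A = F.effect A) : E = F := by
  refine ext_of_measure fun ψ => MeasureTheory.ext_of_generate_finite C hgen hpi (fun A hA => ?_)
    (by rw [measure_univ, measure_univ])
  have hm : MeasurableSet A := hgen ▸ MeasurableSpace.measurableSet_generateFrom hA
  rw [measure_apply _ _ hm, measure_apply _ _ hm, h A hA]

theorem ext_of_prod {E F : Observable K (α × β)}
    (h : ∀ X Y, MeasurableSet X → MeasurableSet Y → E.effect (X ×ˢ Y) = F.effect (X ×ˢ Y)) :
    E = F := by
  refine ext_of_generateFrom _ generateFrom_prod.symm isPiSystem_prod ?_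
  rintro _ ⟨X, hX, Y, hY, rfl⟩
  exact h X Y hX hY

section OfMeasure

variable (e : Set α → K →L[ℂ] K) (μ : K → Measure α)
  (not_measurable : ∀ A, ¬ MeasurableSet A → e A = 0)
  (inner_self : ∀ A, MeasurableSet A → ∀ ψ, ⟪e A ψ, ψ⟫_ℂ = ((μ ψ).real A : ℂ))
  (measure_univ : ∀ ψ, (μ ψ).real Set.univ = ‖ψ‖ ^ 2)

include inner_self in
theorem isPositive_of_measure {A : Set α} (hA : MeasurableSet A) : (e A).IsPositive := by
  rw [ContinuousLinearMap.isPositive_iff_complex]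
  intro ψ
  rw [inner_self A hA ψ]
  exact ⟨rfl, measureReal_nonneg⟩

variable [∀ ψ, IsFiniteMeasure (μ ψ)]

/-- The observable whose diagonal matrix elements `⟪e A ψ, ψ⟫` are the values of given finite
measures of total mass `‖ψ‖²`; polarization makes the other matrix elements `σ`-additive. -/
def ofMeasure : Observable K α where
  effect := e
  effect_of_not_measurableSet := not_measurable
  isPositive _ hA := isPositive_of_measure e μ inner_self hA
  effect_univ := clm_ext_inner_self fun ψ => by
    rw [← (isPositive_of_measure e μ inner_self MeasurableSet.univ).isSymmetric.apply_clm,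
      inner_self _ MeasurableSet.univ, measure_univ, one_apply_eq_self,
      inner_self_eq_norm_sq_to_K]
    norm_cast
  hasSum_inner A hA hd φ ψ := by
    have polarization : ∀ B, MeasurableSet B → ⟪φ, e B ψ⟫_ℂ =
        ((μ (ψ + φ)).real B - (μ (ψ - φ)).real B + Complex.I * (μ (ψ + Complex.I • φ)).real B -
          Complex.I * (μ (ψ - Complex.I • φ)).real B) / 4 := fun B hB => by
      rw [← (isPositive_of_measure e μ inner_self hB).isSymmetric.apply_clm]
      simpa only [ContinuousLinearMap.coe_coe, inner_self B hB]
        using inner_map_polarization (e B : K →ₗ[ℂ] K) ψ φ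
    have additive : ∀ χ, HasSum (fun n => ((μ χ).real (A n) : ℂ)) ((μ χ).real (⋃ n, A n)) :=
      fun χ => Complex.hasSum_ofReal.2 (hasSum_measureReal_iUnion (μ χ) hA hd)
    simp only [fun n => polarization (A n) (hA n), polarization _ (MeasurableSet.iUnion hA)]
    exact ((((additive _).sub (additive _)).add ((additive _).mul_left _)).sub
      ((additive _).mul_left _)).div_const _

end OfMeasure

/-- The image of an observable under a measurable map of the outcomes. -/
def map (E : Observable K α) (f : α → β) (hf : Measurable f) : Observable K β where
  effect A := open Classical in if MeasurableSet A then E.effect (f ⁻¹' A) else 0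
  effect_of_not_measurableSet A hA := by simp [hA]
  isPositive A hA := by simpa [hA] using E.isPositive _ (hf hA)
  effect_univ := by simpa using E.effect_univ
  hasSum_inner A hA hd φ ψ := by
    simp only [hA, MeasurableSet.iUnion hA, if_true, Set.preimage_iUnion]
    exact E.hasSum_inner _ (fun n => hf (hA n)) (fun m n hmn => (hd hmn).preimage f) φ ψ

theorem map_effect (E : Observable K α) {f : α → β} (hf : Measurable f) {A : Set β}
    (hA : MeasurableSet A) : (E.map f hf).effect A = E.effect (f ⁻¹' A) := by
  simp [map, hA]

theorem measure_map (E : Observable K α) {f : α → β} (hf : Measurable f) (ψ : K) :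
    (E.map f hf).measure ψ = (E.measure ψ).map f := by
  ext A hA
  rw [measure_apply _ _ hA, map_effect _ _ hA, Measure.map_apply hf hA, measure_apply _ _ (hf hA)]

theorem IsProjectionValued.map {E : Observable K α} (hE : E.IsProjectionValued) {f : α → β}
    (hf : Measurable f) : (E.map f hf).IsProjectionValued := fun A hA => by
  rw [map_effect _ _ hA]
  exact hE _ (hf hA)

theorem summable_measureReal_univ (E : Observable K α) {ι : Type*} {ψ : ι → K}
    (hψ : Summable fun k => ‖ψ k‖ ^ 2) : Summable fun k => (E.measure (ψ k)).real Set.univ := by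
  simpa only [measureReal_univ] using hψ

variable [CompleteSpace K] [CompleteSpace L]

/-- The compression `A ↦ V* E(A) V` of an observable by an isometry `V`. -/
def conj (E : Observable K α) (V : L →L[ℂ] K) (hV : adjoint V ∘L V = 1) :
    Observable L α where
  effect A := adjoint V ∘L E.effect A ∘L V
  effect_of_not_measurableSet A hA := by simp [E.effect_of_not_measurableSet A hA]
  isPositive A hA := by
    simpa using (E.isPositive A hA).conj_adjoint (adjoint V)
  effect_univ := by
    rw [E.effect_univ, ← hV]; rfl
  hasSum_inner A hA hd φ ψ := by
    simpa [ContinuousLinearMap.adjoint_inner_right] using E.hasSum_inner A hA hd (V φ) (V ψ)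

theorem conj_effect (E : Observable K α) (V : L →L[ℂ] K)
    (hV : adjoint V ∘L V = 1) (A : Set α) :
    (E.conj V hV).effect A = adjoint V ∘L E.effect A ∘L V := rfl

theorem measure_conj (E : Observable K α) (V : L →L[ℂ] K)
    (hV : adjoint V ∘L V = 1) (ψ : L) :
    (E.conj V hV).measure ψ = E.measure (V ψ) := by
  ext A hA
  rw [measure_apply _ _ hA, measure_apply _ _ hA, conj_effect]
  simp [ContinuousLinearMap.adjoint_inner_right]

theorem IsProjectionValued.conj {E : Observable K α} (hE : E.IsProjectionValued) (V : L →L[ℂ] K)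
    (hV : adjoint V ∘L V = 1) (hV' : V ∘L adjoint V = 1) :
    (E.conj V hV).IsProjectionValued := fun A hA => by
  have hVV' : ∀ x, V (adjoint V x) = x := fun x => DFunLike.congr_fun hV' x
  have hidem : ∀ x, E.effect A (E.effect A x) = E.effect A x := fun x =>
    DFunLike.congr_fun (hE A hA).eq x
  ext x
  simp [conj_effect, hVV', hidem]

section SumConj

variable (E : Observable K α) {ι : Type*} {J : ι → L →L[ℂ] K}
  (hJs : Summable fun k => ‖J k‖ ^ 2) (hJ : ∀ φ, HasSum (fun k => ‖J k φ‖ ^ 2) (‖φ‖ ^ 2))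

include hJs in
theorem summable_compression (A : Set α) :
    Summable fun k => adjoint (J k) ∘L E.effect A ∘L J k := by
  refine Summable.of_norm_bounded (hJs.mul_left ‖E.effect A‖) fun k => ?_
  calc ‖adjoint (J k) ∘L E.effect A ∘L J k‖
      ≤ ‖adjoint (J k)‖ * (‖E.effect A‖ * ‖J k‖) :=
        (ContinuousLinearMap.opNorm_comp_le _ _).trans
          (by gcongr; exact ContinuousLinearMap.opNorm_comp_le _ _)
    _ = ‖E.effect A‖ * ‖J k‖ ^ 2 := by rw [LinearIsometryEquiv.norm_map]; ring

include hJs in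
theorem hasSum_inner_compression (A : Set α) (φ ψ : L) :
    HasSum (fun k => ⟪J k φ, E.effect A (J k ψ)⟫_ℂ)
      ⟪φ, (∑' k, adjoint (J k) ∘L E.effect A ∘L J k) ψ⟫_ℂ := by
  have hsum := ((innerSL ℂ φ) ∘L (ContinuousLinearMap.apply ℂ L ψ)).hasSum
    (E.summable_compression hJs A).hasSum
  simpa [Function.comp_def, ContinuousLinearMap.adjoint_inner_right] using hsum

include hJs hJ in
theorem inner_compression_self {A : Set α} (hA : MeasurableSet A) (ψ : L) :
    ⟪(∑' k, adjoint (J k) ∘L E.effect A ∘L J k) ψ, ψ⟫_ℂ =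
      ((Measure.sum fun k => E.measure (J k ψ)).real A : ℂ) := by
  have hsum := E.hasSum_inner_compression hJs A ψ ψ
  simp only [E.inner_effect_self _ hA] at hsum
  rw [← inner_conj_symm, hsum.unique (Complex.hasSum_ofReal.2
    (hasSum_measureReal_sum (E.summable_measureReal_univ (hJ ψ).summable) hA)), Complex.conj_ofReal]

/-- The observable `A ↦ ∑ₖ Jₖ* E(A) Jₖ`, where `∑ₖ Jₖ* Jₖ = 1`. -/
def sumConj : Observable L α :=
  have (ψ : L) : IsFiniteMeasure (Measure.sum fun k => E.measure (J k ψ)) :=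
    isFiniteMeasure_sum (E.summable_measureReal_univ (hJ ψ).summable)
  ofMeasure (fun A => ∑' k, adjoint (J k) ∘L E.effect A ∘L J k)
    (fun ψ => Measure.sum fun k => E.measure (J k ψ))
    (fun A hA => by simp [E.effect_of_not_measurableSet A hA])
    (fun _ hA => E.inner_compression_self hJs hJ hA)
    (fun ψ => by
      refine (hasSum_measureReal_sum (E.summable_measureReal_univ (hJ ψ).summable)
        MeasurableSet.univ).unique ?_
      simpa only [measureReal_univ] using hJ ψ)

theorem hasSum_inner_sumConj (A : Set α) (φ ψ : L) :
    HasSum (fun k => ⟪J k φ, E.effect A (J k ψ)⟫_ℂ) ⟪φ, (E.sumConj hJs hJ).effect A ψ⟫_ℂ :=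
  E.hasSum_inner_compression hJs A φ ψ

theorem adjoint_comp_sumConj_effect_comp {W : L →L[ℂ] L} {W' : K →L[ℂ] K}
    (hW : ∀ k, J k ∘L W = W' ∘L J k) {A B : Set α}
    (hAB : adjoint W' ∘L E.effect B ∘L W' = E.effect A) :
    adjoint W ∘L (E.sumConj hJs hJ).effect B ∘L W =
      (E.sumConj hJs hJ).effect A := by
  refine clm_ext_inner_self fun φ => ?_
  have hJW : ∀ k, J k (W φ) = W' (J k φ) := fun k => DFunLike.congr_fun (hW k) φ
  have hB := E.hasSum_inner_sumConj hJs hJ B (W φ) (W φ)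
  simp only [hJW, ← ContinuousLinearMap.adjoint_inner_right W'] at hB
  have hA := E.hasSum_inner_sumConj hJs hJ A φ φ
  simp only [← hAB] at hA
  rw [ContinuousLinearMap.comp_apply, ContinuousLinearMap.adjoint_inner_right]
  exact hB.unique hA

end SumConj

end Observable

end Operations

/-! ### Uniqueness of spectral measures -/

namespace Observable

section ProjectionValued

variable {K : Type*} [NormedAddCommGroup K] [InnerProductSpace ℂ K]
  {α : Type*} [MeasurableSpace α] {E : Observable K α}

theorem effect_union (E : Observable K α) {A B : Set α} (hA : MeasurableSet A)
    (hB : MeasurableSet B) (hd : Disjoint A B) :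
    E.effect (A ∪ B) = E.effect A + E.effect B := by
  refine clm_ext_inner_self fun ψ => ?_
  rw [add_apply, inner_add_right, E.inner_effect_self _ (hA.union hB),
    E.inner_effect_self _ hA, E.inner_effect_self _ hB, measureReal_union hd hB]
  exact Complex.ofReal_add _ _

theorem effect_compl (E : Observable K α) {A : Set α} (hA : MeasurableSet A) :
    E.effect Aᶜ = 1 - E.effect A := by
  rw [eq_sub_iff_add_eq', ← E.effect_union hA hA.compl disjoint_compl_right, Set.union_compl_self,
    E.effect_univ]

namespace IsProjectionValued

theorem effect_mul_of_disjoint (hE : E.IsProjectionValued) {A B : Set α} (hA : MeasurableSet A)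
    (hB : MeasurableSet B) (hd : Disjoint A B) : E.effect A * E.effect B = 0 := by
  have isAddTorsionFree : IsAddTorsionFree (K →L[ℂ] K) := .of_isTorsionFree ℂ _
  have hAB := hE _ (hA.union hB)
  rw [E.effect_union hA hB hd, IsIdempotentElem.add_iff (hE A hA) (hE B hB)] at hAB
  exact (hE A hA).mul_eq_zero_of_anticommute hAB

theorem effect_mul (hE : E.IsProjectionValued) {A B : Set α} (hA : MeasurableSet A)
    (hB : MeasurableSet B) : E.effect A * E.effect B = E.effect (A ∩ B) := by
  have hAB := hA.inter hB
  have splitA : E.effect A = E.effect (A ∩ B) + E.effect (A \ B) := by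
    rw [← E.effect_union hAB (hA.diff hB) Set.disjoint_sdiff_inter.symm, Set.inter_union_sdiff]
  have splitB : E.effect B = E.effect (A ∩ B) + E.effect (B \ A) := by
    rw [← E.effect_union hAB (hB.diff hA)
      (Set.disjoint_sdiff_right.mono_left Set.inter_subset_left), Set.inter_comm A B,
      Set.inter_union_sdiff]
  rw [splitB, mul_add, effect_mul_of_disjoint hE hA (hB.diff hA) Set.disjoint_sdiff_right,
    add_zero, splitA, add_mul, effect_mul_of_disjoint hE (hA.diff hB) hAB
      (Set.disjoint_sdiff_left.mono_right Set.inter_subset_right), add_zero]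
  exact (hE _ hAB).eq

theorem effect_effect (hE : E.IsProjectionValued) {A B : Set α} (hA : MeasurableSet A)
    (hB : MeasurableSet B) (ψ : K) : E.effect A (E.effect B ψ) = E.effect (A ∩ B) ψ := by
  rw [← hE.effect_mul hA hB, mul_apply_eq_comp]

theorem effect_apply_self (hE : E.IsProjectionValued) {A : Set α} (hA : MeasurableSet A) (ψ : K) :
    E.effect A (E.effect A ψ) = E.effect A ψ := by
  rw [hE.effect_effect hA hA, Set.inter_self]

theorem measure_effect (hE : E.IsProjectionValued) {A : Set α} (hA : MeasurableSet A) (ψ : K) :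
    E.measure (E.effect A ψ) = (E.measure ψ).restrict A := by
  ext B hB
  rw [Measure.restrict_apply hB, measure_apply _ _ hB, measure_apply _ _ (hB.inter hA),
    ← E.inner_effect_comm, hE.effect_effect hB hA, hE.effect_effect hA (hB.inter hA),
    Set.inter_eq_self_of_subset_right Set.inter_subset_right]

theorem ae_mem (hE : E.IsProjectionValued) {A : Set α} (hA : MeasurableSet A) {ψ : K}
    (h : E.effect A ψ = ψ) : ∀ᵐ x ∂(E.measure ψ), x ∈ A := by
  rw [← h, hE.measure_effect hA]
  exact ae_restrict_mem hA

theorem inner_effect_eq_zero (hE : E.IsProjectionValued) {A B : Set α} (hA : MeasurableSet A)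
    (hB : MeasurableSet B) {φ ψ : K} (hφ : E.effect A φ = φ) (hψ : E.effect A ψ = 0) :
    ⟪φ, E.effect B ψ⟫_ℂ = 0 := by
  rw [← hφ, ← E.inner_effect_comm, hE.effect_effect hA hB, Set.inter_comm,
    ← hE.effect_effect hB hA, hψ, map_zero, inner_zero_right]

theorem measure_add (hE : E.IsProjectionValued) {A : Set α} (hA : MeasurableSet A) {φ ψ : K}
    (hφ : E.effect A φ = φ) (hψ : E.effect A ψ = 0) :
    E.measure (φ + ψ) = E.measure φ + E.measure ψ := by
  ext B hB
  have hφψ := hE.inner_effect_eq_zero hA hB hφ hψ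
  have hψφ : ⟪ψ, E.effect B φ⟫_ℂ = 0 := by
    rw [E.inner_effect_comm, inner_eq_zero_symm, hφψ]
  have hadd : ⟪φ + ψ, E.effect B (φ + ψ)⟫_ℂ = ⟪φ, E.effect B φ⟫_ℂ + ⟪ψ, E.effect B ψ⟫_ℂ := by
    rw [map_add, inner_add_left, inner_add_right, inner_add_right, hφψ, hψφ, add_zero, zero_add]
  rw [Measure.add_apply, measure_apply _ _ hB, measure_apply _ _ hB, measure_apply _ _ hB, hadd,
    Complex.add_re, ENNReal.ofReal_add]
  · exact (E.isPositive B hB).re_inner_nonneg_right φ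
  · exact (E.isPositive B hB).re_inner_nonneg_right ψ

theorem effect_eq_zero_of_measure (hE : E.IsProjectionValued) {A : Set α} (hA : MeasurableSet A)
    {ψ : K} (h : E.measure ψ A = 0) : E.effect A ψ = 0 := by
  have hself := E.inner_effect_self ψ hA
  rw [Measure.real, h, ← hE.effect_apply_self hA, E.inner_effect_comm] at hself
  simpa using hself

end IsProjectionValued

end ProjectionValued

end Observable

section QuadraticForm

variable {K : Type*} [NormedAddCommGroup K] [InnerProductSpace ℂ K]

-- Think of `y = S x` and `z = S y` for a symmetric `S`: polarization turns the bound `r` on the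
-- quadratic form of `S` at the vectors `x ± t • y` into a bound on `‖S x‖`.
theorem norm_le_of_forall_abs_re_inner_le {x y z : K} {r : ℝ} (hxz : ⟪x, z⟫_ℂ = ⟪y, y⟫_ℂ)
    (hr : ∀ t : ℝ, |(⟪x + (t : ℂ) • y, y + (t : ℂ) • z⟫_ℂ).re| ≤ r * ‖x + (t : ℂ) • y‖ ^ 2) :
    ‖y‖ ≤ r * ‖x‖ := by
  have polarization : ∀ t : ℝ, (⟪x + (t : ℂ) • y, y + (t : ℂ) • z⟫_ℂ).re -
      (⟪x + ((-t : ℝ) : ℂ) • y, y + ((-t : ℝ) : ℂ) • z⟫_ℂ).re = 4 * t * ‖y‖ ^ 2 := fun t => by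
    have inner_polarization : ⟪x + (t : ℂ) • y, y + (t : ℂ) • z⟫_ℂ -
        ⟪x + ((-t : ℝ) : ℂ) • y, y + ((-t : ℝ) : ℂ) • z⟫_ℂ =
        ((4 * t * ‖y‖ ^ 2 : ℝ) : ℂ) := by
      simp only [inner_add_left, inner_add_right, inner_smul_left, inner_smul_right,
        Complex.conj_ofReal, hxz, inner_self_eq_norm_sq_to_K, Complex.coe_algebraMap]
      push_cast
      ring
    rw [← Complex.sub_re, inner_polarization, Complex.ofReal_re]
  have parallelogram : ∀ t : ℝ, ‖x + (t : ℂ) • y‖ ^ 2 + ‖x + ((-t : ℝ) : ℂ) • y‖ ^ 2 =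
      2 * (‖x‖ ^ 2 + t ^ 2 * ‖y‖ ^ 2) := fun t => by
    have law := parallelogram_law_with_norm ℂ x ((t : ℂ) • y)
    rw [norm_smul, Complex.norm_real, Real.norm_eq_abs] at law
    rw [Complex.ofReal_neg, neg_smul, ← sub_eq_add_neg, ← sq_abs t]
    linear_combination law
  have bound : ∀ t : ℝ, 2 * t * ‖y‖ ^ 2 ≤ r * (‖x‖ ^ 2 + t ^ 2 * ‖y‖ ^ 2) := fun t => by
    have hsum : r * (‖x + (t : ℂ) • y‖ ^ 2 + ‖x + ((-t : ℝ) : ℂ) • y‖ ^ 2) =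
        r * (2 * (‖x‖ ^ 2 + t ^ 2 * ‖y‖ ^ 2)) := by rw [parallelogram t]
    linarith [polarization t, (abs_le.1 (hr t)).2, (abs_le.1 (hr (-t))).1]
  rcases eq_or_ne x 0 with rfl | hx
  · rw [inner_zero_left, eq_comm, inner_self_eq_zero] at hxz
    simp [hxz]
  have norm_x_pos : 0 < ‖x‖ := norm_pos_iff.2 hx
  rcases eq_or_ne y 0 with rfl | hy
  · have norm_sq_nonneg := bound 0
    simp only [norm_zero] at norm_sq_nonneg ⊢
    nlinarith
  refine le_of_mul_le_mul_left ?_ (show 0 < 2 * ‖x‖ by positivity)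
  calc 2 * ‖x‖ * ‖y‖ = 2 * (‖x‖ / ‖y‖) * ‖y‖ ^ 2 := by field_simp
    _ ≤ r * (‖x‖ ^ 2 + (‖x‖ / ‖y‖) ^ 2 * ‖y‖ ^ 2) := bound _
    _ = 2 * ‖x‖ * (r * ‖x‖) := by field_simp; ring

end QuadraticForm

namespace Observable.IsSpectralMeasure

variable {K : Type*} [NormedAddCommGroup K] [InnerProductSpace ℂ K]
  {E F : Observable K ℝ} {T : K →ₗ.[ℂ] K}

theorem inner_eq_of_mem_graph (hE : E.IsSpectralMeasure T) {φ φ' : K} (h : (φ, φ') ∈ T.graph) :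
    ⟪φ, φ'⟫_ℂ = ((∫ x : ℝ, x ∂(E.measure φ) : ℝ) : ℂ) := by
  obtain ⟨y, rfl, rfl⟩ := T.mem_graph_iff.1 h
  exact hE.inner_eq y

theorem integrable_sq (hE : E.IsSpectralMeasure T) {φ φ' : K} (h : (φ, φ') ∈ T.graph) :
    Integrable (fun x : ℝ => x ^ 2) (E.measure φ) :=
  (hE.mem_domain_iff φ).1 (T.mem_domain_of_mem_graph h)

theorem integrable_id (hE : E.IsSpectralMeasure T) {φ φ' : K} (h : (φ, φ') ∈ T.graph) :
    Integrable (fun x : ℝ => x) (E.measure φ) :=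
  ((memLp_two_iff_integrable_sq (by fun_prop)).2 (hE.integrable_sq h)).integrable (by norm_num)

theorem exists_mem_graph (hE : E.IsSpectralMeasure T) {φ : K}
    (h : Integrable (fun x : ℝ => x ^ 2) (E.measure φ)) : ∃ φ', (φ, φ') ∈ T.graph :=
  ⟨T ⟨φ, (hE.mem_domain_iff φ).2 h⟩, T.mem_graph ⟨φ, (hE.mem_domain_iff φ).2 h⟩⟩

theorem exists_mem_graph_Icc (hE : E.IsSpectralMeasure T) (a b : ℝ) (φ : K) :
    ∃ φ', (E.effect (Set.Icc a b) φ, φ') ∈ T.graph := by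
  refine hE.exists_mem_graph ?_
  rw [hE.isProjectionValued.measure_effect measurableSet_Icc]
  exact (continuous_pow 2).continuousOn.integrableOn_compact isCompact_Icc

theorem inner_self_comm (hE : E.IsSpectralMeasure T) {φ φ' : K} (h : (φ, φ') ∈ T.graph) :
    ⟪φ, φ'⟫_ℂ = ⟪φ', φ⟫_ℂ := by
  rw [← inner_conj_symm φ' φ, hE.inner_eq_of_mem_graph h, Complex.conj_ofReal]

theorem inner_comm (hE : E.IsSpectralMeasure T) {φ φ' ψ ψ' : K} (hφ : (φ, φ') ∈ T.graph)
    (hψ : (ψ, ψ') ∈ T.graph) : ⟪φ, ψ'⟫_ℂ = ⟪φ', ψ⟫_ℂ := by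
  have diagφ := hE.inner_self_comm hφ
  have diagψ := hE.inner_self_comm hψ
  have sum := hE.inner_self_comm (T.graph.add_mem hφ hψ)
  have sumI := hE.inner_self_comm (T.graph.add_mem hφ (T.graph.smul_mem Complex.I hψ))
  simp only [Prod.smul_mk, inner_add_left, inner_add_right, inner_smul_left, inner_smul_right,
    Complex.conj_I] at sum sumI
  linear_combination (sum - diagφ - diagψ) / 2 -
    Complex.I / 2 * (sumI - diagφ + Complex.I * Complex.I * diagψ) +
    (⟪φ, ψ'⟫_ℂ - ⟪ψ, φ'⟫_ℂ - ⟪φ', ψ⟫_ℂ + ⟪ψ', φ⟫_ℂ) / 2 * Complex.I_mul_I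

theorem re_inner_eq_zero (hE : E.IsSpectralMeasure T) {A : Set ℝ} (hA : MeasurableSet A)
    {φ φ' ψ ψ' : K} (hφ : (φ, φ') ∈ T.graph) (hψ : (ψ, ψ') ∈ T.graph)
    (hAφ : E.effect A φ = φ) (hAψ : E.effect A ψ = 0) : (⟪φ, ψ'⟫_ℂ).re = 0 := by
  have hsum := hE.inner_eq_of_mem_graph (T.graph.add_mem hφ hψ)
  have hμ := hE.isProjectionValued.measure_add hA hAφ hAψ
  simp only [hμ] at hsum
  rw [integral_add_measure (hE.integrable_id hφ) (hE.integrable_id hψ)] at hsum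
  simp only [inner_add_left, inner_add_right, Complex.ofReal_add,
    ← hE.inner_eq_of_mem_graph hφ, ← hE.inner_eq_of_mem_graph hψ] at hsum
  have hcross : ⟪φ, ψ'⟫_ℂ + (starRingEnd ℂ) ⟪φ, ψ'⟫_ℂ = 0 := by
    rw [hE.inner_comm hφ hψ, inner_conj_symm, ← hE.inner_comm hφ hψ]
    linear_combination hsum
  rw [Complex.add_conj] at hcross
  simpa using hcross

theorem inner_eq_zero (hE : E.IsSpectralMeasure T) {A : Set ℝ} (hA : MeasurableSet A)
    {φ φ' ψ ψ' : K} (hφ : (φ, φ') ∈ T.graph) (hψ : (ψ, ψ') ∈ T.graph)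
    (hAφ : E.effect A φ = φ) (hAψ : E.effect A ψ = 0) : ⟪φ, ψ'⟫_ℂ = 0 := by
  have hI := hE.re_inner_eq_zero hA hφ (T.graph.smul_mem Complex.I hψ) hAφ (by simp [hAψ])
  refine Complex.ext (hE.re_inner_eq_zero hA hφ hψ hAφ hAψ) ?_
  simpa [inner_smul_right] using hI

theorem eq_zero_of_forall_inner (hE : E.IsSpectralMeasure T) {η : K}
    (h : ∀ φ φ', (φ, φ') ∈ T.graph → ⟪φ, η⟫_ℂ = 0) : η = 0 := by
  have hIcc : ∀ a b : ℝ, E.measure η (Set.Icc a b) = 0 := fun a b => by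
    obtain ⟨φ', hφ'⟩ := hE.exists_mem_graph_Icc a b η
    rw [measure_apply _ _ measurableSet_Icc, E.inner_effect_comm, h _ _ hφ']
    simp
  have huniv : E.measure η Set.univ = 0 := measure_null_of_locally_null _ fun x _ =>
    ⟨_, mem_nhdsWithin_of_mem_nhds (Icc_mem_nhds (sub_one_lt x) (lt_add_one x)), hIcc _ _⟩
  rw [E.measure_univ, ENNReal.ofReal_eq_zero] at huniv
  simpa using huniv.antisymm (by positivity)

theorem effect_mem_graph (hE : E.IsSpectralMeasure T) {A : Set ℝ} (hA : MeasurableSet A)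
    {ψ ψ' : K} (hψ : (ψ, ψ') ∈ T.graph) : (E.effect A ψ, E.effect A ψ') ∈ T.graph := by
  have hp := hE.isProjectionValued
  have effect_mem_domain : ∀ {φ φ' : K}, (φ, φ') ∈ T.graph →
      ∃ η, (E.effect A φ, η) ∈ T.graph := by
    intro φ φ' hφ
    refine hE.exists_mem_graph ?_
    rw [hp.measure_effect hA]
    exact (hE.integrable_sq hφ).restrict
  have effect_sub : ∀ χ, E.effect A (χ - E.effect A χ) = 0 := fun χ => by
    rw [map_sub, hp.effect_apply_self hA, sub_self]
  obtain ⟨η, hη⟩ := effect_mem_domain hψ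
  suffices η - E.effect A ψ' = 0 by rwa [sub_eq_zero.1 this] at hη
  refine hE.eq_zero_of_forall_inner fun φ φ' hφ => ?_
  obtain ⟨ξ, hξ⟩ := effect_mem_domain hφ
  have horth := hE.inner_eq_zero hA hη (T.graph.sub_mem hφ hξ) (hp.effect_apply_self hA ψ)
    (effect_sub φ)
  rw [hE.inner_comm hη (T.graph.sub_mem hφ hξ), inner_eq_zero_symm] at horth
  have horth' := hE.inner_eq_zero hA hξ (T.graph.sub_mem hψ hη) (hp.effect_apply_self hA φ)
    (effect_sub ψ)
  rw [inner_sub_left] at horth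
  rw [inner_sub_right] at horth'
  rw [inner_sub_right, E.inner_effect_comm]
  linear_combination horth - horth'

theorem effect_apply_eq (hE : E.IsSpectralMeasure T) {A : Set ℝ} (hA : MeasurableSet A)
    {ψ ψ' : K} (hψ : (ψ, ψ') ∈ T.graph) (h : E.effect A ψ = ψ) : E.effect A ψ' = ψ' :=
  T.mem_graph_snd_inj' (hE.effect_mem_graph hA hψ) hψ h

theorem inner_sub_smul (hE : E.IsSpectralMeasure T) {ψ ψ' : K} (hψ : (ψ, ψ') ∈ T.graph) (m : ℝ) :
    ⟪ψ, ψ' - (m : ℂ) • ψ⟫_ℂ = ((∫ x : ℝ, (x - m) ∂(E.measure ψ) : ℝ) : ℂ) := by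
  rw [inner_sub_right, inner_smul_right, hE.inner_eq_of_mem_graph hψ,
    integral_sub (hE.integrable_id hψ) (integrable_const m), integral_const,
    E.measureReal_univ, inner_self_eq_norm_sq_to_K]
  simp only [Complex.coe_algebraMap, smul_eq_mul, Complex.ofReal_sub, Complex.ofReal_mul,
    Complex.ofReal_pow]
  ring

theorem abs_re_inner_sub_smul_le (hE : E.IsSpectralMeasure T) {m r : ℝ} {ψ ψ' : K}
    (hψ : (ψ, ψ') ∈ T.graph) (h : E.effect (Set.Icc (m - r) (m + r)) ψ = ψ) :
    |(⟪ψ, ψ' - (m : ℂ) • ψ⟫_ℂ).re| ≤ r * ‖ψ‖ ^ 2 := by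
  rw [hE.inner_sub_smul hψ, Complex.ofReal_re, ← E.measureReal_univ ψ, ← Real.norm_eq_abs]
  refine norm_integral_le_of_norm_le_const ?_
  filter_upwards [hE.isProjectionValued.ae_mem measurableSet_Icc h] with x hx
  rw [Real.norm_eq_abs, abs_le]
  constructor <;> linarith [hx.1, hx.2]

theorem norm_sub_smul_le (hE : E.IsSpectralMeasure T) {m r : ℝ} {ψ ψ' : K}
    (hψ : (ψ, ψ') ∈ T.graph) (h : E.effect (Set.Icc (m - r) (m + r)) ψ = ψ) :
    ‖ψ' - (m : ℂ) • ψ‖ ≤ r * ‖ψ‖ := by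
  set χ := ψ' - (m : ℂ) • ψ with hχ
  have hχA : E.effect (Set.Icc (m - r) (m + r)) χ = χ := by
    rw [hχ, map_sub, map_smul, h, hE.effect_apply_eq measurableSet_Icc hψ h]
  obtain ⟨χ', hχ'⟩ := hE.exists_mem_graph_Icc (m - r) (m + r) χ
  rw [hχA] at hχ'
  refine norm_le_of_forall_abs_re_inner_le (z := χ' - (m : ℂ) • χ) ?_ fun t => ?_
  · rw [inner_sub_right, inner_smul_right, hE.inner_comm hψ hχ']
    nth_rewrite 3 [hχ]
    rw [inner_sub_left, inner_smul_left, Complex.conj_ofReal]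
  · have hsplit : χ + (t : ℂ) • (χ' - (m : ℂ) • χ) =
        ψ' + (t : ℂ) • χ' - (m : ℂ) • (ψ + (t : ℂ) • χ) := by
      rw [hχ]; module
    rw [hsplit]
    exact hE.abs_re_inner_sub_smul_le (T.graph.add_mem hψ (T.graph.smul_mem (t : ℂ) hχ'))
      (by simp only [map_add, map_smul, h, hχA])

theorem le_norm_sub_smul (hE : E.IsSpectralMeasure T) {m c : ℝ} {ψ ψ' : K}
    (hψ : (ψ, ψ') ∈ T.graph) (h : E.effect (Set.Ici c) ψ = ψ) :
    (c - m) * ‖ψ‖ ≤ ‖ψ' - (m : ℂ) • ψ‖ := by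
  rcases eq_or_ne ψ 0 with rfl | hψ0
  · simp
  refine le_of_mul_le_mul_left ?_ (norm_pos_iff.2 hψ0)
  calc ‖ψ‖ * ((c - m) * ‖ψ‖) = ∫ _, (c - m) ∂(E.measure ψ) := by
        rw [integral_const, E.measureReal_univ, smul_eq_mul]; ring
    _ ≤ ∫ x : ℝ, (x - m) ∂(E.measure ψ) := by
        refine integral_mono_ae (integrable_const _)
          ((hE.integrable_id hψ).sub (integrable_const m)) ?_
        filter_upwards [hE.isProjectionValued.ae_mem measurableSet_Ici h] with x hx
        exact sub_le_sub_right hx m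
    _ ≤ ‖⟪ψ, ψ' - (m : ℂ) • ψ⟫_ℂ‖ := by
        rw [hE.inner_sub_smul hψ, Complex.norm_real]
        exact le_abs_self _
    _ ≤ ‖ψ‖ * ‖ψ' - (m : ℂ) • ψ‖ := norm_inner_le_norm ψ _

theorem pow_mul_norm_le (hE : E.IsSpectralMeasure T) (hF : F.IsSpectralMeasure T) {m r c : ℝ}
    (hr : 0 ≤ r) (hc : m + r < c) (n : ℕ) (ψ : K)
    (h : E.effect (Set.Icc (m - r) (m + r)) ψ = ψ) :
    (c - m) ^ n * ‖F.effect (Set.Ici c) ψ‖ ≤ r ^ n * (‖F.effect (Set.Ici c)‖ * ‖ψ‖) := by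
  induction n generalizing ψ with
  | zero => simpa using ContinuousLinearMap.le_opNorm _ _
  | succ n ih =>
    obtain ⟨ψ', hψ'⟩ := hE.exists_mem_graph_Icc (m - r) (m + r) ψ
    rw [h] at hψ'
    have hih := ih (ψ' - (m : ℂ) • ψ) (by
      rw [map_sub, map_smul, h, hE.effect_apply_eq measurableSet_Icc hψ' h])
    have hlower := hF.le_norm_sub_smul (m := m) (hF.effect_mem_graph measurableSet_Ici hψ')
      (hF.isProjectionValued.effect_apply_self (measurableSet_Ici (a := c)) ψ)
    have hupper := hE.norm_sub_smul_le hψ' h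
    have hcm : 0 ≤ c - m := by linarith
    rw [map_sub, map_smul] at hih
    calc (c - m) ^ (n + 1) * ‖F.effect (Set.Ici c) ψ‖
        = (c - m) ^ n * ((c - m) * ‖F.effect (Set.Ici c) ψ‖) := by ring
      _ ≤ (c - m) ^ n * ‖F.effect (Set.Ici c) ψ' - (m : ℂ) • F.effect (Set.Ici c) ψ‖ := by gcongr
      _ ≤ r ^ n * (‖F.effect (Set.Ici c)‖ * ‖ψ' - (m : ℂ) • ψ‖) := hih
      _ ≤ r ^ n * (‖F.effect (Set.Ici c)‖ * (r * ‖ψ‖)) := by gcongr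
      _ = r ^ (n + 1) * (‖F.effect (Set.Ici c)‖ * ‖ψ‖) := by ring

theorem effect_Ici_effect_Icc (hE : E.IsSpectralMeasure T) (hF : F.IsSpectralMeasure T)
    {a b c : ℝ} (hab : a ≤ b) (hbc : b < c) (ψ : K) :
    F.effect (Set.Ici c) (E.effect (Set.Icc a b) ψ) = 0 := by
  obtain ⟨m, r, hr, rfl, rfl⟩ : ∃ m r : ℝ, 0 ≤ r ∧ m - r = a ∧ m + r = b :=
    ⟨(a + b) / 2, (b - a) / 2, by linarith, by ring, by ring⟩
  set χ := E.effect (Set.Icc (m - r) (m + r)) ψ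
  have hcm : 0 < c - m := by linarith
  have hpow : ∀ n : ℕ, ‖F.effect (Set.Ici c) χ‖ ≤
      (r / (c - m)) ^ n * (‖F.effect (Set.Ici c)‖ * ‖χ‖) := fun n => by
    rw [div_pow, div_mul_eq_mul_div, le_div_iff₀ (by positivity), mul_comm]
    exact hE.pow_mul_norm_le hF hr hbc n χ
      (hE.isProjectionValued.effect_apply_self measurableSet_Icc ψ)
  have hlim := (tendsto_pow_atTop_nhds_zero_of_lt_one (div_nonneg hr hcm.le)
    ((div_lt_one hcm).2 (by linarith))).mul_const (‖F.effect (Set.Ici c)‖ * ‖χ‖)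
  rw [zero_mul] at hlim
  exact norm_le_zero_iff.1 (ge_of_tendsto' hlim hpow)

theorem effect_Ici_effect_Ici (hE : E.IsSpectralMeasure T) (hF : F.IsSpectralMeasure T)
    (c : ℝ) (ψ : K) : E.effect (Set.Ici c) (F.effect (Set.Ici c) ψ) = F.effect (Set.Ici c) ψ := by
  set η := F.effect (Set.Ici c) ψ with hη
  have hIcc : ∀ a b : ℝ, a ≤ b → b < c → E.measure η (Set.Icc a b) = 0 := fun a b hab hbc => by
    rw [measure_apply _ _ measurableSet_Icc]
    nth_rewrite 1 [hη]
    rw [← F.inner_effect_comm, hE.effect_Ici_effect_Icc hF hab hbc, inner_zero_right]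
    simp
  have hcompl : E.measure η (Set.Ici c)ᶜ = 0 := measure_null_of_locally_null _ fun x hx => by
    have hxc : x < c := not_le.1 hx
    exact ⟨Set.Icc (x - 1) ((x + c) / 2), mem_nhdsWithin_of_mem_nhds
      (Icc_mem_nhds (by linarith) (by linarith)), hIcc _ _ (by linarith) (by linarith)⟩
  have hzero := hE.isProjectionValued.effect_eq_zero_of_measure measurableSet_Ici.compl hcompl
  rw [E.effect_compl measurableSet_Ici] at hzero
  exact (sub_eq_zero.1 hzero).symm

theorem unique (hE : E.IsSpectralMeasure T) (hF : F.IsSpectralMeasure T) : E = F := by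
  refine ext_of_generateFrom (Set.range Set.Ici)
    (BorelSpace.measurable_eq.trans (borel_eq_generateFrom_Ici ℝ)) isPiSystem_Ici ?_
  rintro _ ⟨c, rfl⟩
  ext ψ
  refine ext_inner_left ℂ fun φ => ?_
  rw [← hE.effect_Ici_effect_Ici hF, E.inner_effect_comm, E.inner_effect_comm,
    F.inner_effect_comm, hF.effect_Ici_effect_Ici hE]

end Observable.IsSpectralMeasure

/-! ### Multiplication operators -/

section Multiplication

variable {α : Type*} [MeasurableSpace α] {μ : Measure α} {m : α → ℂ} {A : Set α}

/-- Multiplication by an essentially bounded function on `L²(μ)`. -/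
def mulOp (hm : MemLp m ∞ μ) : Lp ℂ 2 μ →L[ℂ] Lp ℂ 2 μ :=
  (ContinuousLinearMap.mul ℂ ℂ).holderL μ ∞ 2 2 (hm.toLp m)

theorem mulOp_coeFn (hm : MemLp m ∞ μ) (f : Lp ℂ 2 μ) : mulOp hm f =ᵐ[μ] fun x => m x * f x := by
  filter_upwards [(ContinuousLinearMap.mul ℂ ℂ).coeFn_holder (r := 2) (hm.toLp m) f,
    hm.coeFn_toLp] with x hx hmx
  rw [← hmx]
  exact hx

theorem memLp_indicator_one (hA : MeasurableSet A) : MemLp (A.indicator fun _ => (1 : ℂ)) ∞ μ :=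
  (memLp_top_const 1).indicator hA

/-- The distribution `‖ψ(x)‖² dμ(x)` of the outcomes of a position measurement in the vector state
`ψ`. -/
def bornMeasure (ψ : Lp ℂ 2 μ) : Measure α := μ.withDensity fun x => ‖ψ x‖ₑ ^ 2

theorem measurable_enorm_sq (ψ : Lp ℂ 2 μ) : Measurable fun x => ‖ψ x‖ₑ ^ 2 :=
  (Lp.stronglyMeasurable ψ).measurable.enorm.pow_const 2

theorem integrable_bornMeasure {ψ : Lp ℂ 2 μ} {g : α → ℝ} :
    Integrable g (bornMeasure ψ) ↔ Integrable (fun x => ‖ψ x‖ ^ 2 * g x) μ := by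
  rw [bornMeasure, integrable_withDensity_iff_integrable_smul' (measurable_enorm_sq ψ)
    (ae_of_all _ fun x => ENNReal.pow_lt_top enorm_lt_top)]
  simp only [ENNReal.toReal_pow, toReal_enorm, smul_eq_mul]

theorem integral_bornMeasure (ψ : Lp ℂ 2 μ) (g : α → ℝ) :
    ∫ x, g x ∂bornMeasure ψ = ∫ x, ‖ψ x‖ ^ 2 * g x ∂μ := by
  rw [bornMeasure, integral_withDensity_eq_integral_toReal_smul (measurable_enorm_sq ψ)
    (ae_of_all _ fun x => ENNReal.pow_lt_top enorm_lt_top)]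
  simp only [ENNReal.toReal_pow, toReal_enorm, smul_eq_mul]

instance (ψ : Lp ℂ 2 μ) : IsFiniteMeasure (bornMeasure ψ) := by
  rw [← integrable_const_iff_isFiniteMeasure (one_ne_zero (α := ℝ)), integrable_bornMeasure]
  simpa using (Lp.memLp ψ).integrable_norm_pow two_ne_zero

theorem inner_mulOp_indicator_self (hA : MeasurableSet A) (ψ : Lp ℂ 2 μ) :
    ⟪mulOp (memLp_indicator_one hA) ψ, ψ⟫_ℂ = ((bornMeasure ψ).real A : ℂ) := by
  rw [← integral_indicator_one hA, integral_bornMeasure, L2.inner_def, ← integral_complex_ofReal]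
  refine integral_congr_ae ?_
  filter_upwards [mulOp_coeFn (memLp_indicator_one hA) ψ] with x hx
  rw [hx]
  by_cases h : x ∈ A <;> simp [h, ← Complex.conj_mul', mul_comm]

theorem mulOp_indicator_univ : mulOp (memLp_indicator_one (μ := μ) MeasurableSet.univ) = 1 := by
  ext1 ψ
  ext1
  filter_upwards [mulOp_coeFn (memLp_indicator_one MeasurableSet.univ) ψ] with x hx
  simpa using hx

open Classical in
variable (μ) in
/-- The canonical observable on `L²(μ)`, whose effects are the multiplications by indicator
functions. -/
def canonicalObservable : Observable (Lp ℂ 2 μ) α :=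
  .ofMeasure (fun A => if hA : MeasurableSet A then mulOp (memLp_indicator_one hA) else 0)
    bornMeasure
    (fun _ hA => dif_neg hA)
    (fun A hA ψ => by rw [dif_pos hA]; exact inner_mulOp_indicator_self hA ψ)
    (fun ψ => by
      rw [← Complex.ofReal_inj, ← inner_mulOp_indicator_self MeasurableSet.univ,
        mulOp_indicator_univ, one_apply_eq_self, inner_self_eq_norm_sq_to_K]
      norm_cast)

theorem canonicalObservable_effect (hA : MeasurableSet A) :
    (canonicalObservable μ).effect A = mulOp (memLp_indicator_one hA) :=
  dif_pos hA

theorem canonicalObservable_isProjectionValued : (canonicalObservable μ).IsProjectionValued :=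
  fun A hA => by
    rw [canonicalObservable_effect hA]
    ext1 ψ
    ext1
    rw [mul_apply_eq_comp]
    filter_upwards [mulOp_coeFn (memLp_indicator_one hA) ψ,
      mulOp_coeFn (memLp_indicator_one hA) (mulOp (memLp_indicator_one hA) ψ)] with x h1 h2
    rw [h2, h1]
    by_cases h : x ∈ A <;> simp [h]

theorem canonicalObservable_measure (ψ : Lp ℂ 2 μ) :
    (canonicalObservable μ).measure ψ = bornMeasure ψ := by
  ext A hA
  rw [← measureReal_eq_measureReal_iff, ← Complex.ofReal_inj, ← inner_mulOp_indicator_self hA,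
    ← canonicalObservable_effect hA, ← Observable.inner_effect_comm,
    Observable.inner_effect_self _ _ hA]

end Multiplication

/-! ### Tensor products of operators -/

theorem clm_ext_tprod {M : Type*} [NormedAddCommGroup M] [NormedSpace ℂ M] {S T : H₂ →L[ℂ] M}
    (h : ∀ f g, S (tprod f g) = T (tprod f g)) : S = T := by
  refine DFunLike.coe_injective (denseRange_tensorEmb.equalizer S.continuous T.continuous ?_)
  ext x
  simp only [Function.comp_apply]
  induction x with
  | zero => simp only [map_zero]
  | add a b ha hb => simp only [map_add, ha, hb]
  | tmul f g => exact h f g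

theorem tensorOp_comp (S T S' T' : H →L[ℂ] H) :
    tensorOp S T ∘L tensorOp S' T' = tensorOp (S ∘L S') (T ∘L T') :=
  clm_ext_tprod fun f g => by simp [tensorOp_tprod]

theorem tensorOp_adjoint (S T : H →L[ℂ] H) :
    adjoint (tensorOp S T) = tensorOp (adjoint S) (adjoint T) := by
  have inner_tensorOp : ∀ f g, innerSL ℂ (tprod f g) ∘L tensorOp S T =
      innerSL ℂ (tprod (adjoint S f) (adjoint T g)) := fun f g => clm_ext_tprod fun f' g' => by
    simp [tensorOp_tprod, inner_tprod, ContinuousLinearMap.adjoint_inner_left]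
  refine clm_ext_tprod fun f g => ext_inner_right ℂ fun Φ => ?_
  rw [tensorOp_tprod, ContinuousLinearMap.adjoint_inner_left]
  exact DFunLike.congr_fun (inner_tensorOp f g) Φ

theorem norm_tprod (f g : H) : ‖tprod f g‖ = ‖f‖ * ‖g‖ := by
  rw [← sq_eq_sq₀ (norm_nonneg _) (by positivity), mul_pow, ← Complex.ofReal_inj]
  simpa [inner_self_eq_norm_sq_to_K] using inner_tprod f g f g

/-- The operator `f ↦ f ⊗ g`. -/
def tprodLeft (g : H) : H →L[ℂ] H₂ :=
  (tprodₗ.flip g).mkContinuous ‖g‖ fun f => by rw [mul_comm]; exact (norm_tprod f g).le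

/-- The operator `g ↦ f ⊗ g`. -/
def tprodRight (f : H) : H →L[ℂ] H₂ :=
  (tprodₗ f).mkContinuous ‖f‖ fun g => (norm_tprod f g).le

theorem ae_eq_comp_fst {f g : ℝ → ℂ} (h : f =ᵐ[volume] g) :
    (fun z : ℝ × ℝ => f z.1) =ᵐ[volume] fun z => g z.1 :=
  Measure.quasiMeasurePreserving_fst.ae_eq_comp h

theorem ae_eq_comp_snd {f g : ℝ → ℂ} (h : f =ᵐ[volume] g) :
    (fun z : ℝ × ℝ => f z.2) =ᵐ[volume] fun z => g z.2 :=
  Measure.quasiMeasurePreserving_snd.ae_eq_comp h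

theorem tensorOp_canonicalObservable {A B : Set ℝ} (hA : MeasurableSet A) (hB : MeasurableSet B) :
    tensorOp ((canonicalObservable volume).effect A) ((canonicalObservable volume).effect B) =
      (canonicalObservable volume).effect (A ×ˢ B) := by
  rw [canonicalObservable_effect hA, canonicalObservable_effect hB,
    canonicalObservable_effect (hA.prod hB)]
  refine clm_ext_tprod fun f g => ?_
  rw [tensorOp_tprod]
  ext1
  filter_upwards [tprod_coeFn f g, tprod_coeFn (mulOp (memLp_indicator_one hA) f)
      (mulOp (memLp_indicator_one hB) g),
    mulOp_coeFn (memLp_indicator_one (hA.prod hB)) (tprod f g),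
    ae_eq_comp_fst (mulOp_coeFn (memLp_indicator_one hA) f),
    ae_eq_comp_snd (mulOp_coeFn (memLp_indicator_one hB) g)] with z hfg hAB hprod hf hg
  rw [hAB, hprod, hfg, hf, hg]
  by_cases hzA : z.1 ∈ A <;> by_cases hzB : z.2 ∈ B <;>
    simp [Set.indicator, Set.mem_prod, hzA, hzB]

/-! ### Phase shifts and Weyl operators -/

theorem norm_cexp_I_mul (t : ℝ) : ‖Complex.exp (Complex.I * t)‖ = 1 := by
  rw [mul_comm, Complex.norm_exp_ofReal_mul_I]

section PhaseShift

variable {G : Type*} [MeasurableSpace G] {μ : Measure G} {g : G → ℝ}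

theorem memLp_cexp_I_mul (hg : Measurable g) :
    MemLp (fun x => Complex.exp (Complex.I * g x)) ∞ μ :=
  memLp_top_of_bound (by fun_prop) 1 (ae_of_all _ fun x => (norm_cexp_I_mul (g x)).le)

theorem norm_mulOp_cexp_I_mul (hg : Measurable g) (f : Lp ℂ 2 μ) :
    ‖mulOp (memLp_cexp_I_mul hg) f‖ = ‖f‖ := by
  have norm_ae_eq : ∀ᵐ x ∂μ, ‖mulOp (memLp_cexp_I_mul hg) f x‖ = ‖f x‖ := by
    filter_upwards [mulOp_coeFn (memLp_cexp_I_mul hg) f] with x hx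
    rw [hx, norm_mul, norm_cexp_I_mul, one_mul]
  exact le_antisymm (Lp.norm_le_norm_of_ae_le (norm_ae_eq.mono fun _ h => h.le))
    (Lp.norm_le_norm_of_ae_le (norm_ae_eq.mono fun _ h => h.ge))

variable [AddGroup G] [MeasurableAdd G] [μ.IsAddRightInvariant]

/-- The isometry `f ↦ e^{i g(x)} f(x - v)` of `L²(μ)`. -/
def phaseShiftₗᵢ (hg : Measurable g) (v : G) : Lp ℂ 2 μ →ₗᵢ[ℂ] Lp ℂ 2 μ where
  toLinearMap := (mulOp (memLp_cexp_I_mul hg)).toLinearMap ∘ₗ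
    (Lp.compMeasurePreservingₗᵢ ℂ (· - v) (measurePreserving_sub_right μ v)).toLinearMap
  norm_map' f := (norm_mulOp_cexp_I_mul hg _).trans (LinearIsometry.norm_map _ f)

theorem phaseShiftₗᵢ_coeFn (hg : Measurable g) (v : G) (f : Lp ℂ 2 μ) :
    phaseShiftₗᵢ hg v f =ᵐ[μ] fun x => Complex.exp (Complex.I * g x) * f (x - v) := by
  have hv := measurePreserving_sub_right μ v
  filter_upwards [mulOp_coeFn (memLp_cexp_I_mul hg) (Lp.compMeasurePreserving _ hv f),
    Lp.coeFn_compMeasurePreserving f hv] with x hx hx'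
  exact hx.trans (congrArg _ hx')

theorem phaseShiftₗᵢ_surjective (hg : Measurable g) (v : G) :
    Function.Surjective (phaseShiftₗᵢ (μ := μ) hg v) := by
  intro f
  have hg' : Measurable fun x => -g (x + v) := (hg.comp (measurable_add_const v)).neg
  refine ⟨phaseShiftₗᵢ hg' (-v) f, ?_⟩
  ext1
  filter_upwards [phaseShiftₗᵢ_coeFn hg v (phaseShiftₗᵢ hg' (-v) f),
    (measurePreserving_sub_right μ v).quasiMeasurePreserving.ae_eq_comp
      (phaseShiftₗᵢ_coeFn hg' (-v) f)] with x hx hx'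
  rw [Function.comp_apply, Function.comp_apply] at hx'
  rw [hx, hx', ← mul_assoc, ← Complex.exp_add]
  simp

/-- The unitary operator `f ↦ e^{i g(x)} f(x - v)` of `L²(μ)`. -/
def phaseShift (hg : Measurable g) (v : G) : Lp ℂ 2 μ ≃ₗᵢ[ℂ] Lp ℂ 2 μ :=
  .ofSurjective (phaseShiftₗᵢ hg v) (phaseShiftₗᵢ_surjective hg v)

theorem phaseShift_coeFn (hg : Measurable g) (v : G) (f : Lp ℂ 2 μ) :
    phaseShift hg v f =ᵐ[μ] fun x => Complex.exp (Complex.I * g x) * f (x - v) :=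
  phaseShiftₗᵢ_coeFn hg v f

end PhaseShift

theorem adjoint_comp_self {K L : Type*} [NormedAddCommGroup K] [InnerProductSpace ℂ K]
    [CompleteSpace K] [NormedAddCommGroup L] [InnerProductSpace ℂ L] [CompleteSpace L]
    (V : K ≃ₗᵢ[ℂ] L) : adjoint (V : K →L[ℂ] L) ∘L (V : K →L[ℂ] L) = 1 :=
  (ContinuousLinearMap.norm_map_iff_adjoint_comp_self _).1 V.norm_map

theorem self_comp_adjoint {K L : Type*} [NormedAddCommGroup K] [InnerProductSpace ℂ K]
    [CompleteSpace K] [NormedAddCommGroup L] [InnerProductSpace ℂ L] [CompleteSpace L]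
    (V : K ≃ₗᵢ[ℂ] L) : (V : K →L[ℂ] L) ∘L adjoint (V : K →L[ℂ] L) = 1 := by
  ext1 x
  rw [LinearIsometryEquiv.adjoint_eq_symm]
  exact V.apply_symm_apply x

theorem modulation_coeFn (p : ℝ) (f : H) :
    modulation p f =ᵐ[volume] fun x : ℝ => Complex.exp (Complex.I * (p * x)) * f x :=
  (memLp_modulation p f).coeFn_toLp

/-- The Weyl operator `W(q, p)` as a unitary operator, which acts by
`f ↦ e^{i (p x - q p / 2)} f(x - q)`. -/
def weylEquiv (q p : ℝ) : H ≃ₗᵢ[ℂ] H :=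
  phaseShift (g := fun x => p * x - q * p / 2) (by fun_prop) q

theorem weylEquiv_coeFn (q p : ℝ) (f : H) : weylEquiv q p f =ᵐ[volume] fun x : ℝ =>
    Complex.exp (Complex.I * (p * x - q * p / 2 : ℝ)) * f (x - q) :=
  phaseShift_coeFn _ _ _

theorem coe_weylEquiv (q p : ℝ) : (weylEquiv q p : H →L[ℂ] H) = weyl q p := by
  ext1 f
  ext1
  have hq := measurePreserving_sub_right (volume : Measure ℝ) q
  filter_upwards [weylEquiv_coeFn q p f,
    Lp.coeFn_smul (Complex.exp (Complex.I * (q * p / 2))) (translation q (modulation p f)),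
    Lp.coeFn_compMeasurePreserving (modulation p f) hq,
    hq.quasiMeasurePreserving.ae_eq_comp (modulation_coeFn p f)] with x hW hsmul htrans hmod
  refine hW.trans (Eq.trans ?_ hsmul.symm)
  rw [Pi.smul_apply, translation]
  refine Eq.trans ?_ (congrArg _ (htrans.trans hmod).symm)
  rw [Function.comp_apply, smul_eq_mul, ← mul_assoc, ← Complex.exp_add]
  congr 2
  push_cast
  ring

theorem weyl_zero : weyl 0 0 = 1 := by
  rw [← coe_weylEquiv]
  ext1 f
  ext1
  filter_upwards [weylEquiv_coeFn 0 0 f] with x hx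
  simpa using hx

theorem adjoint_weyl_comp_weyl (q p : ℝ) : adjoint (weyl q p) ∘L weyl q p = 1 := by
  rw [← coe_weylEquiv, adjoint_comp_self]

theorem weyl_comp_adjoint_weyl (q p : ℝ) : weyl q p ∘L adjoint (weyl q p) = 1 := by
  rw [← coe_weylEquiv, self_comp_adjoint]

theorem tensorOp_phaseShift {g h : ℝ → ℝ} (hg : Measurable g) (hh : Measurable h) (v w : ℝ) :
    tensorOp (phaseShift (μ := volume) hg v) (phaseShift (μ := volume) hh w) =
      (phaseShift (μ := volume) (g := fun z : ℝ × ℝ => g z.1 + h z.2) (by fun_prop) (v, w) :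
        H₂ →L[ℂ] H₂) := by
  refine clm_ext_tprod fun f f' => ?_
  rw [tensorOp_tprod]
  ext1
  filter_upwards [tprod_coeFn (phaseShift hg v f) (phaseShift hh w f'),
    ae_eq_comp_fst (phaseShift_coeFn hg v f), ae_eq_comp_snd (phaseShift_coeFn hh w f'),
    phaseShift_coeFn (g := fun z : ℝ × ℝ => g z.1 + h z.2) (by fun_prop) (v, w) (tprod f f'),
    (measurePreserving_sub_right volume ((v, w) : ℝ × ℝ)).quasiMeasurePreserving.ae_eq_comp
      (tprod_coeFn f f')] with z hprod hfst hsnd hshift hff'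
  refine hprod.trans (Eq.trans ?_ hshift.symm)
  rw [Function.comp_apply, Function.comp_apply] at hff'
  rw [hfst, hsnd, hff', mul_mul_mul_comm, ← Complex.exp_add, ← mul_add, ← Complex.ofReal_add]
  rfl

theorem beamSplitter_phaseShift {g k : ℝ × ℝ → ℝ} (hg : Measurable g) (hk : Measurable k)
    {v w : ℝ × ℝ} (hgk : ∀ z, g z = k (rot z)) (hvw : rot v = w) (Ψ : H₂) :
    beamSplitter (phaseShift hk w Ψ) = phaseShift hg v (beamSplitter Ψ) := by
  ext1
  filter_upwards [Lp.coeFn_compMeasurePreserving (phaseShift hk w Ψ) measurePreserving_rot,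
    measurePreserving_rot.quasiMeasurePreserving.ae_eq_comp (phaseShift_coeFn hk w Ψ),
    phaseShift_coeFn hg v (beamSplitter Ψ),
    (measurePreserving_sub_right volume v).quasiMeasurePreserving.ae_eq_comp
      (Lp.coeFn_compMeasurePreserving Ψ measurePreserving_rot)] with z hleft hk' hright hΨ
  refine (hleft.trans hk').trans (Eq.trans ?_ hright.symm)
  refine Eq.trans ?_ (congrArg _ hΨ.symm)
  simp only [Function.comp_apply, map_sub, hvw, hgk]

theorem beamSplitter_comp_tensorOp_weyl_one (q p : ℝ) :
    beamSplitter ∘L tensorOp (weyl q p) 1 =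
      tensorOp (weyl (q / √2) (p / √2)) (weyl (q / √2) (p / √2)) ∘L beamSplitter := by
  have sqrt_two_sq : (√2 : ℝ) * √2 = 2 := Real.mul_self_sqrt zero_le_two
  rw [← weyl_zero]
  simp only [← coe_weylEquiv, weylEquiv, tensorOp_phaseShift]
  ext1 Ψ
  refine beamSplitter_phaseShift (by fun_prop) (by fun_prop) (fun z => ?_) ?_ Ψ
  · change _ = p * ((√2)⁻¹ * (z.1 + z.2)) - q * p / 2 + (0 * ((√2)⁻¹ * (-z.1 + z.2)) - 0 * 0 / 2)
    field_simp
    linear_combination q * p * sqrt_two_sq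
  · rw [rot_apply]
    refine Prod.ext ?_ ?_
    · change (√2)⁻¹ * (q / √2 + q / √2) = q
      field_simp
      linear_combination -q * sqrt_two_sq
    · change (√2)⁻¹ * (-(q / √2) + q / √2) = 0
      ring

/-! ### Quadratures on Schwartz functions -/

theorem iteratedDeriv_cexp_I_mul_ofReal (n : ℕ) :
    (iteratedDeriv n fun t : ℝ => Complex.exp (Complex.I * t)) =
      fun t : ℝ => Complex.I ^ n * Complex.exp (Complex.I * t) := by
  induction n with
  | zero => simp
  | succ n ih =>
    rw [iteratedDeriv_succ, ih]
    ext t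
    have hexp : HasDerivAt (fun t : ℝ => Complex.exp (Complex.I * t))
        (Complex.exp (Complex.I * t) * (Complex.I * 1)) t :=
      ((hasDerivAt_id t).ofReal_comp.const_mul Complex.I).cexp
    rw [(hexp.const_mul (Complex.I ^ n)).deriv]
    ring

theorem hasTemperateGrowth_cexp_I_mul_ofReal :
    (fun t : ℝ => Complex.exp (Complex.I * t)).HasTemperateGrowth := by
  refine ⟨(contDiff_const.mul Complex.ofRealCLM.contDiff).cexp, fun n => ⟨0, 1, fun t => ?_⟩⟩
  rw [norm_iteratedFDeriv_eq_norm_iteratedDeriv, iteratedDeriv_cexp_I_mul_ofReal, norm_mul,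
    norm_pow, Complex.norm_I, one_pow, norm_cexp_I_mul]
  simp

theorem ofReal_add_I_ne_zero (x : ℝ) : (x : ℂ) + Complex.I ≠ 0 := fun h => by
  simpa using congrArg Complex.im h

theorem hasTemperateGrowth_inv_ofReal_add_I :
    (fun x : ℝ => ((x : ℂ) + Complex.I)⁻¹).HasTemperateGrowth := by
  have inv_eq : (fun x : ℝ => ((x : ℂ) + Complex.I)⁻¹) =
      fun x : ℝ => ((x : ℂ) - Complex.I) * (((1 + ‖x‖ ^ 2) ^ (-1 : ℝ) : ℝ) : ℂ) := by
    ext x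
    have one_add_sq_ne_zero : (1 : ℂ) + (x : ℂ) ^ 2 ≠ 0 := by
      exact_mod_cast (by positivity : (0 : ℝ) < 1 + x ^ 2).ne'
    rw [Real.rpow_neg_one, Real.norm_eq_abs, sq_abs]
    push_cast
    field_simp [ofReal_add_I_ne_zero x]
    linear_combination Complex.I_sq
  rw [inv_eq]
  have := Function.hasTemperateGrowth_one_add_norm_sq_rpow ℝ (-1)
  fun_prop

theorem schwartzEmb_coeFn (f : 𝓢(ℝ, ℂ)) : schwartzEmb f =ᵐ[volume] f :=
  SchwartzMap.coeFn_toLp f 2 volume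

theorem denseRange_schwartzEmb : DenseRange schwartzEmb :=
  SchwartzMap.denseRange_toLpCLM (E := ℝ) (F := ℂ) (p := 2) (μ := volume) ENNReal.ofNat_ne_top

theorem quadratureS_apply (θ : ℝ) (f : 𝓢(ℝ, ℂ)) (x : ℝ) :
    quadratureS θ f x = Real.cos θ * (x * f x) - Complex.I * Real.sin θ * deriv f x := by
  have unfolded : quadratureS θ f x = (√2 : ℂ)⁻¹ *
      (Complex.exp (Complex.I * θ) * ((√2 : ℂ)⁻¹ * (posS f x - deriv f x)) +
        Complex.exp (-(Complex.I * θ)) * ((√2 : ℂ)⁻¹ * (posS f x + deriv f x))) := rfl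
  have inv_sqrt_two_sq : (√2 : ℂ)⁻¹ * (√2 : ℂ)⁻¹ = 1 / 2 := by
    rw [← mul_inv, ← Complex.ofReal_mul, Real.mul_self_sqrt zero_le_two]
    norm_num
  rw [unfolded, posS_apply, mul_comm Complex.I, ← neg_mul, Complex.exp_mul_I, Complex.exp_mul_I,
    Complex.cos_neg, Complex.sin_neg, Complex.ofReal_cos, Complex.ofReal_sin]
  linear_combination
    (2 * Complex.cos θ * (x * f x) - 2 * Complex.I * Complex.sin θ * deriv f x) * inv_sqrt_two_sq

section SchwartzPhaseShift

variable {k : ℝ → ℝ}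

/-- The map `f ↦ e^{i k(x)} f(x - v)` on Schwartz functions. -/
def schwartzPhaseShift (k : ℝ → ℝ) (v : ℝ) : 𝓢(ℝ, ℂ) →L[ℂ] 𝓢(ℝ, ℂ) :=
  SchwartzMap.smulLeftCLM ℂ (fun x => Complex.exp (Complex.I * k x)) ∘L
    SchwartzMap.compSubConstCLM ℂ v

theorem schwartzPhaseShift_apply (hk : k.HasTemperateGrowth) (v : ℝ) (f : 𝓢(ℝ, ℂ)) (x : ℝ) :
    schwartzPhaseShift k v f x = Complex.exp (Complex.I * k x) * f (x - v) := by
  have hexp : (fun x => Complex.exp (Complex.I * k x)).HasTemperateGrowth :=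
    hasTemperateGrowth_cexp_I_mul_ofReal.comp hk
  exact SchwartzMap.smulLeftCLM_apply_apply hexp _ x

theorem schwartzPhaseShift_surjective (hk : k.HasTemperateGrowth) (v : ℝ) :
    Function.Surjective (schwartzPhaseShift k v) := by
  intro f
  have hk' : (fun x => -k (x + v)).HasTemperateGrowth := by fun_prop
  refine ⟨schwartzPhaseShift (fun x => -k (x + v)) (-v) f, ?_⟩
  ext x
  rw [schwartzPhaseShift_apply hk, schwartzPhaseShift_apply hk', ← mul_assoc, ← Complex.exp_add]
  simp

theorem phaseShift_schwartzEmb (hk : k.HasTemperateGrowth) (v : ℝ) (f : 𝓢(ℝ, ℂ)) :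
    phaseShift hk.1.continuous.measurable v (schwartzEmb f) =
      schwartzEmb (schwartzPhaseShift k v f) := by
  ext1
  filter_upwards [phaseShift_coeFn hk.1.continuous.measurable v (schwartzEmb f),
    (measurePreserving_sub_right volume v).quasiMeasurePreserving.ae_eq_comp (schwartzEmb_coeFn f),
    schwartzEmb_coeFn (schwartzPhaseShift k v f)] with x hshift hf hSf
  rw [Function.comp_apply, Function.comp_apply] at hf
  rw [hshift, hf, hSf, schwartzPhaseShift_apply hk]

theorem quadratureS_schwartzPhaseShift (hk : k.HasTemperateGrowth) (θ v : ℝ) {x k' : ℝ}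
    (hk' : HasDerivAt k k' x) (f : 𝓢(ℝ, ℂ)) :
    quadratureS θ (schwartzPhaseShift k v f) x = schwartzPhaseShift k v (quadratureS θ f) x +
      (v * Real.cos θ + k' * Real.sin θ : ℝ) * schwartzPhaseShift k v f x := by
  have hderiv : HasDerivAt (schwartzPhaseShift k v f)
      (Complex.exp (Complex.I * k x) * (Complex.I * k') * f (x - v) +
        Complex.exp (Complex.I * k x) * deriv f (x - v)) x := by
    rw [funext (schwartzPhaseShift_apply hk v f)]
    exact (hk'.ofReal_comp.const_mul Complex.I).cexp.mul
      ((f.hasDerivAt (x - v)).comp_sub_const x v)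
  simp only [quadratureS_apply, schwartzPhaseShift_apply hk, hderiv.deriv, Complex.ofReal_add,
    Complex.ofReal_mul, Complex.ofReal_sub]
  linear_combination (-Real.sin θ * k' * Complex.exp (Complex.I * k x) * f (x - v)) * Complex.I_sq

end SchwartzPhaseShift

/-! ### The graph of a quadrature -/

theorem isClosable_of_forall_mem_closure_graph {K : Type*} [NormedAddCommGroup K]
    [NormedSpace ℂ K] {T : K →ₗ.[ℂ] K}
    (h : ∀ η, ((0, η) : K × K) ∈ closure (T.graph : Set (K × K)) → η = 0) : T.IsClosable :=
  ⟨T.graph.topologicalClosure.toLinearPMap, (Submodule.toLinearPMap_graph_eq _ fun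
    | (_, η), hz, rfl => h η hz).symm⟩

/-- The quadrature on the domain of Schwartz functions. -/
def schwartzQuadrature (θ : ℝ) : H →ₗ.[ℂ] H where
  domain := LinearMap.range schwartzEmb
  toFun := schwartzEmb ∘ₗ (quadratureS θ : 𝓢(ℝ, ℂ) →ₗ[ℂ] 𝓢(ℝ, ℂ)) ∘ₗ
    (LinearEquiv.ofInjective schwartzEmb schwartzEmb_injective).symm.toLinearMap

theorem graph_schwartzQuadrature (θ : ℝ) : ((schwartzQuadrature θ).graph : Set (H × H)) =
    Set.range fun f => (schwartzEmb f, schwartzEmb (quadratureS θ f)) := by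
  have apply_schwartzEmb (f) (hf : schwartzEmb f ∈ LinearMap.range schwartzEmb) :
      schwartzQuadrature θ ⟨schwartzEmb f, hf⟩ = schwartzEmb (quadratureS θ f) :=
    congrArg (fun g => schwartzEmb (quadratureS θ g))
      ((LinearEquiv.symm_apply_eq _).2 (Subtype.ext rfl))
  ext z
  rw [SetLike.mem_coe, LinearPMap.mem_graph_iff]
  constructor
  · rintro ⟨⟨_, f, rfl⟩, hfst, hsnd⟩
    exact ⟨f, Prod.ext hfst (((apply_schwartzEmb f _).symm).trans hsnd)⟩
  · rintro ⟨f, rfl⟩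
    exact ⟨⟨schwartzEmb f, f, rfl⟩, rfl, apply_schwartzEmb f _⟩

theorem graph_quadrature_of_isClosable {θ : ℝ} (h : (schwartzQuadrature θ).IsClosable) :
    ((quadrature θ).graph : Set (H × H)) = closure (schwartzQuadrature θ).graph :=
  congrArg SetLike.coe h.graph_closure_eq_closure_graph.symm

theorem memLp_inv_ofReal_add_I :
    MemLp (fun x : ℝ => ((x : ℂ) + Complex.I)⁻¹) ∞ (volume : Measure ℝ) := by
  refine memLp_top_of_bound (by fun_prop) 1 (ae_of_all _ fun x => ?_)
  rw [norm_inv]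
  refine inv_le_one_of_one_le₀ ?_
  simpa using Complex.abs_im_le_norm ((x : ℂ) + Complex.I)

/-- The parametrization `u ↦ ((x + i)⁻¹ u, x (x + i)⁻¹ u)` of the graph of the multiplication by
`x`, which exhibits this graph as a closed subspace. -/
def positionGraphMap : H →L[ℂ] H × H :=
  (mulOp memLp_inv_ofReal_add_I).prod (1 - Complex.I • mulOp memLp_inv_ofReal_add_I)

theorem isClosedEmbedding_positionGraphMap : Topology.IsClosedEmbedding positionGraphMap := by
  have leftInverse : Function.LeftInverse (fun z : H × H => z.2 + Complex.I • z.1)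
      positionGraphMap := fun u => sub_add_cancel u _
  exact leftInverse.isClosedEmbedding (by fun_prop) positionGraphMap.continuous

theorem positionGraphMap_add_I_smul {ψ η : H} (h : η =ᵐ[volume] fun x : ℝ => x * ψ x) :
    positionGraphMap (η + Complex.I • ψ) = (ψ, η) := by
  have fst_eq : mulOp memLp_inv_ofReal_add_I (η + Complex.I • ψ) = ψ := by
    ext1
    filter_upwards [h, mulOp_coeFn memLp_inv_ofReal_add_I (η + Complex.I • ψ),
      Lp.coeFn_add η (Complex.I • ψ), Lp.coeFn_smul Complex.I ψ] with x hη hmul hadd hsmul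
    rw [hmul, hadd, Pi.add_apply, hsmul, Pi.smul_apply, hη, smul_eq_mul, ← add_mul,
      inv_mul_cancel_left₀ (ofReal_add_I_ne_zero x)]
  refine Prod.ext fst_eq ?_
  change η + Complex.I • ψ - Complex.I • mulOp _ (η + Complex.I • ψ) = η
  rw [fst_eq, add_sub_cancel_right]

theorem mem_range_positionGraphMap {ψ η : H} :
    (ψ, η) ∈ Set.range positionGraphMap ↔ η =ᵐ[volume] fun x : ℝ => x * ψ x := by
  refine ⟨?_, fun h => ⟨_, positionGraphMap_add_I_smul h⟩⟩
  rintro ⟨u, hu⟩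
  obtain ⟨hψ, hη⟩ : mulOp memLp_inv_ofReal_add_I u = ψ ∧ u - Complex.I • ψ = η := by
    obtain ⟨rfl, rfl⟩ := Prod.ext_iff.1 hu
    exact ⟨rfl, rfl⟩
  have hmul := mulOp_coeFn memLp_inv_ofReal_add_I u
  rw [hψ] at hmul
  rw [← hη]
  filter_upwards [hmul, Lp.coeFn_sub u (Complex.I • ψ), Lp.coeFn_smul Complex.I ψ]
    with x hψ hsub hsmul
  rw [hsub, Pi.sub_apply, hsmul, Pi.smul_apply, smul_eq_mul, hψ]
  field_simp [ofReal_add_I_ne_zero x]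
  ring

theorem quadratureS_zero_apply (f : 𝓢(ℝ, ℂ)) (x : ℝ) : quadratureS 0 f x = x * f x := by
  simp [quadratureS_apply]

theorem quadratureS_zero_add_I_smul_surjective :
    Function.Surjective fun f : 𝓢(ℝ, ℂ) => quadratureS 0 f + Complex.I • f := by
  intro f
  refine ⟨SchwartzMap.smulLeftCLM ℂ (fun x : ℝ => ((x : ℂ) + Complex.I)⁻¹) f, ?_⟩
  ext x
  change quadratureS 0 _ x + Complex.I * _ = f x
  rw [quadratureS_zero_apply,
    SchwartzMap.smulLeftCLM_apply_apply hasTemperateGrowth_inv_ofReal_add_I, smul_eq_mul,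
    ← add_mul, mul_inv_cancel_left₀ (ofReal_add_I_ne_zero x)]

theorem positionGraphMap_schwartzEmb (f : 𝓢(ℝ, ℂ)) :
    positionGraphMap (schwartzEmb (quadratureS 0 f + Complex.I • f)) =
      (schwartzEmb f, schwartzEmb (quadratureS 0 f)) := by
  rw [map_add, map_smul]
  refine positionGraphMap_add_I_smul ?_
  filter_upwards [schwartzEmb_coeFn f, schwartzEmb_coeFn (quadratureS 0 f)] with x hf hQf
  rw [hQf, hf, quadratureS_zero_apply]

theorem closure_graph_schwartzQuadrature_zero :
    closure ((schwartzQuadrature 0).graph : Set (H × H)) = Set.range positionGraphMap := by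
  have graph_eq : ((schwartzQuadrature 0).graph : Set (H × H)) =
      positionGraphMap '' Set.range schwartzEmb := by
    rw [graph_schwartzQuadrature, ← Set.range_comp,
      ← quadratureS_zero_add_I_smul_surjective.range_comp (positionGraphMap ∘ schwartzEmb)]
    exact congrArg Set.range (funext fun f => (positionGraphMap_schwartzEmb f).symm)
  rw [graph_eq, isClosedEmbedding_positionGraphMap.closure_image_eq,
    denseRange_schwartzEmb.closure_range, Set.image_univ]

theorem isClosable_schwartzQuadrature_zero : (schwartzQuadrature 0).IsClosable := by
  refine isClosable_of_forall_mem_closure_graph fun η hη => ?_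
  rw [closure_graph_schwartzQuadrature_zero, mem_range_positionGraphMap] at hη
  ext1
  filter_upwards [hη, Lp.coeFn_zero ℂ 2 (volume : Measure ℝ)] with x hηx hzero
  rw [hηx, hzero, Pi.zero_apply, mul_zero]

theorem mem_graph_quadrature_zero {ψ η : H} :
    (ψ, η) ∈ (quadrature 0).graph ↔ η =ᵐ[volume] fun x : ℝ => x * ψ x := by
  rw [← SetLike.mem_coe, graph_quadrature_of_isClosable isClosable_schwartzQuadrature_zero,
    closure_graph_schwartzQuadrature_zero, mem_range_positionGraphMap]

theorem canonicalObservable_isSpectralMeasure :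
    (canonicalObservable (volume : Measure ℝ)).IsSpectralMeasure (quadrature 0) where
  isProjectionValued := canonicalObservable_isProjectionValued
  mem_domain_iff ψ := by
    have hmeas : AEStronglyMeasurable (fun x : ℝ => x * ψ x) volume :=
      Complex.continuous_ofReal.aestronglyMeasurable.mul (Lp.aestronglyMeasurable ψ)
    have integrable_iff : Integrable (fun x : ℝ => x ^ 2) (bornMeasure ψ) ↔
        MemLp (fun x : ℝ => x * ψ x) 2 volume := by
      rw [integrable_bornMeasure, memLp_two_iff_integrable_sq_norm hmeas]
      simp only [norm_mul, Complex.norm_real, Real.norm_eq_abs, mul_pow, sq_abs, mul_comm]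
    rw [canonicalObservable_measure, integrable_iff, LinearPMap.mem_domain_iff]
    simp only [mem_graph_quadrature_zero]
    exact ⟨fun ⟨η, hη⟩ => (memLp_congr_ae hη).1 (Lp.memLp η), fun h => ⟨h.toLp, h.coeFn_toLp⟩⟩
  inner_eq ψ := by
    rw [canonicalObservable_measure, integral_bornMeasure, L2.inner_def, ← integral_complex_ofReal]
    refine integral_congr_ae ?_
    filter_upwards [mem_graph_quadrature_zero.1 ((quadrature 0).mem_graph ψ)] with x hx
    rw [hx, RCLike.inner_apply, mul_assoc, Complex.mul_conj']
    push_cast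
    ring

/-! ### Diagonalization and covariance of the quadratures -/

section AffineConj

variable {K L : Type*} [NormedAddCommGroup K] [InnerProductSpace ℂ K] [NormedAddCommGroup L]
  [InnerProductSpace ℂ L]

/-- The homeomorphism `(ψ, η) ↦ (V ψ, κ⁻¹ (V η - s V ψ))`, under which the graph of an operator `T`
pulls back to the graph of `V* (κ T + s) V`. -/
def affineConj (V : K ≃ₗᵢ[ℂ] L) {κ : ℝ} (hκ : κ ≠ 0) (s : ℝ) : K × K ≃ₜ L × L where
  toFun z := (V z.1, (κ : ℂ)⁻¹ • (V z.2 - (s : ℂ) • V z.1))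
  invFun w := (V.symm w.1, V.symm ((κ : ℂ) • w.2 + (s : ℂ) • w.1))
  left_inv z := by
    simp only [smul_inv_smul₀ (Complex.ofReal_ne_zero.2 hκ), sub_add_cancel,
      LinearIsometryEquiv.symm_apply_apply]
  right_inv w := by
    simp only [LinearIsometryEquiv.apply_symm_apply, add_sub_cancel_right,
      inv_smul_smul₀ (Complex.ofReal_ne_zero.2 hκ)]
  continuous_toFun := by fun_prop
  continuous_invFun := by fun_prop

theorem Observable.IsSpectralMeasure.conj_map [CompleteSpace K] [CompleteSpace L]
    {E : Observable L ℝ} {T : L →ₗ.[ℂ] L} {T' : K →ₗ.[ℂ] K} (hE : E.IsSpectralMeasure T)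
    (V : K ≃ₗᵢ[ℂ] L) {κ : ℝ} (hκ : κ ≠ 0) (s : ℝ)
    (hT : ∀ z, z ∈ T'.graph ↔ affineConj V hκ s z ∈ T.graph) :
    ((E.map (fun x => κ * x + s) (by fun_prop)).conj (V : K →L[ℂ] L)
      (adjoint_comp_self V)).IsSpectralMeasure T' where
  isProjectionValued := (hE.isProjectionValued.map _).conj _ _ (self_comp_adjoint V)
  mem_domain_iff ψ := by
    have domain_iff : ψ ∈ T'.domain ↔ V ψ ∈ T.domain := by
      simp only [LinearPMap.mem_domain_iff, hT]
      refine ⟨fun ⟨η, h⟩ => ⟨_, h⟩, fun ⟨ζ, h⟩ => ⟨((affineConj V hκ s).symm (V ψ, ζ)).2, ?_⟩⟩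
      rwa [show (ψ, ((affineConj V hκ s).symm (V ψ, ζ)).2) = (affineConj V hκ s).symm (V ψ, ζ) from
        Prod.ext (V.symm_apply_apply ψ).symm rfl, Homeomorph.apply_symm_apply]
    rw [domain_iff, hE.mem_domain_iff, measure_conj, measure_map,
      integrable_map_measure (by fun_prop) (by fun_prop), Function.comp_def,
      ← memLp_two_iff_integrable_sq (by fun_prop), ← memLp_two_iff_integrable_sq (by fun_prop)]
    refine ⟨fun h => (h.const_mul κ).add (memLp_const s), fun h => ?_⟩
    simpa [Pi.sub_def, hκ] using (h.sub (memLp_const s)).const_mul κ⁻¹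
  inner_eq ψ := by
    have hV : (V ψ, (κ : ℂ)⁻¹ • (V (T' ψ) - (s : ℂ) • V ψ)) ∈ T.graph := (hT _).1 (T'.mem_graph ψ)
    have norm_sq : ⟪(ψ : K), (ψ : K)⟫_ℂ = ((‖(ψ : K)‖ ^ 2 : ℝ) : ℂ) :=
      (inner_self_eq_norm_sq_to_K _).trans (Complex.ofReal_pow _ _).symm
    have hinner := hE.inner_eq_of_mem_graph hV
    rw [inner_smul_right, inner_sub_right, inner_smul_right, V.inner_map_map, V.inner_map_map,
      norm_sq, inv_mul_eq_iff_eq_mul₀ (Complex.ofReal_ne_zero.2 hκ), sub_eq_iff_eq_add] at hinner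
    have integral_affine : ∫ x, (κ * x + s) ∂E.measure (V ψ) =
        κ * ∫ x, x ∂E.measure (V ψ) + ‖(ψ : K)‖ ^ 2 * s := by
      rw [integral_add ((hE.integrable_id hV).const_mul κ) (integrable_const s),
        integral_const_mul, integral_const, measureReal_univ, V.norm_map, smul_eq_mul]
    rw [measure_conj, measure_map, integral_map (by fun_prop) (by fun_prop)]
    refine hinner.trans (Eq.trans ?_ (congrArg Complex.ofReal integral_affine).symm)
    push_cast
    ring

end AffineConj

/-- The unitary operator `V`, which acts by the bijection `S` on Schwartz functions, turns the
quadrature `Q_θ` into `κ Q_θ' + s`. -/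
structure Intertwines (V : H ≃ₗᵢ[ℂ] H) (κ s θ θ' : ℝ) (S : 𝓢(ℝ, ℂ) → 𝓢(ℝ, ℂ)) : Prop where
  ne_zero : κ ≠ 0
  surjective : Function.Surjective S
  map_schwartzEmb : ∀ f, V (schwartzEmb f) = schwartzEmb (S f)
  map_quadratureS : ∀ f x, S (quadratureS θ f) x = κ * quadratureS θ' (S f) x + s * S f x

namespace Intertwines

variable {V : H ≃ₗᵢ[ℂ] H} {κ s θ θ' : ℝ} {S : 𝓢(ℝ, ℂ) → 𝓢(ℝ, ℂ)}

theorem affineConj_schwartzEmb (h : Intertwines V κ s θ θ' S) (f : 𝓢(ℝ, ℂ)) :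
    affineConj V h.ne_zero s (schwartzEmb f, schwartzEmb (quadratureS θ f)) =
      (schwartzEmb (S f), schwartzEmb (quadratureS θ' (S f))) := by
  have hS : S (quadratureS θ f) = (κ : ℂ) • quadratureS θ' (S f) + (s : ℂ) • S f :=
    DFunLike.ext _ _ (h.map_quadratureS f)
  refine Prod.ext (h.map_schwartzEmb f) ?_
  change (κ : ℂ)⁻¹ • (V (schwartzEmb (quadratureS θ f)) - (s : ℂ) • V (schwartzEmb f)) = _
  rw [h.map_schwartzEmb, h.map_schwartzEmb, hS, map_add, map_smul, map_smul, add_sub_cancel_right,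
    inv_smul_smul₀ (Complex.ofReal_ne_zero.2 h.ne_zero)]

theorem closure_graph (h : Intertwines V κ s θ θ' S) :
    closure ((schwartzQuadrature θ).graph : Set (H × H)) =
      affineConj V h.ne_zero s ⁻¹' closure (schwartzQuadrature θ').graph := by
  have image_graph : affineConj V h.ne_zero s '' (schwartzQuadrature θ).graph =
      (schwartzQuadrature θ').graph := by
    rw [graph_schwartzQuadrature, graph_schwartzQuadrature, ← Set.range_comp,
      ← h.surjective.range_comp fun f => (schwartzEmb f, schwartzEmb (quadratureS θ' f))]
    exact congrArg Set.range (funext h.affineConj_schwartzEmb)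
  rw [← image_graph, Homeomorph.preimage_closure, Set.preimage_image_eq _ (Homeomorph.injective _)]

theorem isClosable (h : Intertwines V κ s θ θ' S) (hθ' : (schwartzQuadrature θ').IsClosable) :
    (schwartzQuadrature θ).IsClosable := by
  refine isClosable_of_forall_mem_closure_graph fun η hη => ?_
  rw [h.closure_graph, ← graph_quadrature_of_isClosable hθ'] at hη
  have hVη : (κ : ℂ)⁻¹ • (V η - (s : ℂ) • V 0) = 0 :=
    (quadrature θ').graph_fst_eq_zero_snd hη (map_zero V)
  simpa [h.ne_zero] using hVη

theorem mem_graph_quadrature (h : Intertwines V κ s θ θ' S)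
    (hθ' : (schwartzQuadrature θ').IsClosable) (z : H × H) :
    z ∈ (quadrature θ).graph ↔ affineConj V h.ne_zero s z ∈ (quadrature θ').graph := by
  rw [← SetLike.mem_coe, ← SetLike.mem_coe, graph_quadrature_of_isClosable hθ',
    graph_quadrature_of_isClosable (h.isClosable hθ'), h.closure_graph, Set.mem_preimage]

end Intertwines

theorem fourier_derivCLM (f : 𝓢(ℝ, ℂ)) (x : ℝ) :
    FourierTransform.fourier (SchwartzMap.derivCLM ℂ ℂ f) x =
      2 * Real.pi * Complex.I * x * FourierTransform.fourier f x :=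
  congrFun (Real.fourier_deriv f.integrable f.differentiable
    (SchwartzMap.derivCLM ℂ ℂ f).integrable) x

theorem intertwines_refl_of_sin_eq_zero {θ : ℝ} (hθ : Real.sin θ = 0) :
    Intertwines (LinearIsometryEquiv.refl ℂ H) (Real.cos θ) 0 θ 0 id where
  ne_zero := fun h => by simpa [hθ, h] using Real.sin_sq_add_cos_sq θ
  surjective := Function.surjective_id
  map_schwartzEmb _ := rfl
  map_quadratureS f x := by
    rw [id, id, quadratureS_apply, hθ, quadratureS_zero_apply]
    simp

theorem hasTemperateGrowth_chirp (c : ℝ) :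
    (fun x : ℝ => c * x ^ 2 / 2).HasTemperateGrowth := by
  simp only [div_eq_mul_inv]
  fun_prop

/- The chirp `e^{i c x² / 2}` with `c = cot θ` removes the position part of `Q_θ`, and the Fourier
transform turns what is left, a multiple of the momentum, into a multiple of the position. -/
theorem intertwines_chirp_trans_fourier {θ : ℝ} (hθ : Real.sin θ ≠ 0) :
    Intertwines
      ((phaseShift (hasTemperateGrowth_chirp (Real.cos θ / Real.sin θ)).1.continuous.measurable
        0).trans (Lp.fourierTransformₗᵢ ℝ ℂ))
      (2 * Real.pi * Real.sin θ) 0 θ 0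
      fun f => FourierTransform.fourier
        (schwartzPhaseShift (fun x => Real.cos θ / Real.sin θ * x ^ 2 / 2) 0 f) where
  ne_zero := by positivity
  surjective := (FourierTransform.fourierEquiv ℂ 𝓢(ℝ, ℂ)).surjective.comp
    (schwartzPhaseShift_surjective (hasTemperateGrowth_chirp _) 0)
  map_schwartzEmb f := by
    rw [LinearIsometryEquiv.trans_apply, phaseShift_schwartzEmb (hasTemperateGrowth_chirp _)]
    exact SchwartzMap.toLp_fourier_eq _
  map_quadratureS f x := by
    set C := schwartzPhaseShift (fun x => Real.cos θ / Real.sin θ * x ^ 2 / 2) 0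
    have chirp_quadratureS : C (quadratureS θ f) =
        (-(Complex.I * Real.sin θ)) • SchwartzMap.derivCLM ℂ ℂ (C f) := by
      ext y
      have hderiv : HasDerivAt (fun x => Real.cos θ / Real.sin θ * x ^ 2 / 2)
          (Real.cos θ / Real.sin θ * (2 * y) / 2) y := by
        simpa using ((hasDerivAt_pow 2 y).const_mul (Real.cos θ / Real.sin θ)).div_const 2
      have hphase := quadratureS_schwartzPhaseShift (hasTemperateGrowth_chirp _) θ 0 hderiv f
      have cancel : (0 * Real.cos θ + Real.cos θ / Real.sin θ * (2 * y) / 2 * Real.sin θ : ℝ) =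
          Real.cos θ * y := by
        field_simp
        ring
      rw [cancel, quadratureS_apply] at hphase
      rw [smul_apply, SchwartzMap.derivCLM_apply, smul_eq_mul]
      push_cast at hphase ⊢
      linear_combination -hphase
    rw [chirp_quadratureS, FourierTransform.fourier_smul, smul_apply, fourier_derivCLM,
      quadratureS_zero_apply, smul_eq_mul]
    push_cast
    linear_combination
      (-2 * Real.pi * Complex.sin θ * x * FourierTransform.fourier (C f) x) * Complex.I_sq

theorem intertwines_weylEquiv (θ q p : ℝ) :
    Intertwines (weylEquiv q p) 1 (-(q * Real.cos θ + p * Real.sin θ)) θ θ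
      (schwartzPhaseShift (fun x => p * x - q * p / 2) q) := by
  have hk : (fun x : ℝ => p * x - q * p / 2).HasTemperateGrowth := by fun_prop
  exact
    { ne_zero := one_ne_zero
      surjective := schwartzPhaseShift_surjective hk q
      map_schwartzEmb := phaseShift_schwartzEmb hk q
      map_quadratureS := fun f x => by
        have hderiv : HasDerivAt (fun x : ℝ => p * x - q * p / 2) p x := by
          simpa using ((hasDerivAt_id x).const_mul p).sub_const (q * p / 2)
        rw [quadratureS_schwartzPhaseShift hk θ q hderiv]
        push_cast
        ring }

theorem exists_intertwines_zero (θ : ℝ) : ∃ V κ s S, Intertwines V κ s θ 0 S := by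
  by_cases hθ : Real.sin θ = 0
  · exact ⟨_, _, _, _, intertwines_refl_of_sin_eq_zero hθ⟩
  · exact ⟨_, _, _, _, intertwines_chirp_trans_fourier hθ⟩

theorem isClosable_schwartzQuadrature (θ : ℝ) : (schwartzQuadrature θ).IsClosable :=
  let ⟨_, _, _, _, h⟩ := exists_intertwines_zero θ
  h.isClosable isClosable_schwartzQuadrature_zero

theorem Observable.IsSpectralMeasure.map_sub_conj_weyl {θ : ℝ} {E : Observable H ℝ}
    (hE : E.IsSpectralMeasure (quadrature θ)) (q p : ℝ) :
    (E.map (fun x => x - (q * Real.cos θ + p * Real.sin θ)) (by fun_prop)).conj (weyl q p)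
      (adjoint_weyl_comp_weyl q p) = E := by
  have conj_eq := (hE.conj_map (weylEquiv q p) one_ne_zero (-(q * Real.cos θ + p * Real.sin θ))
    ((intertwines_weylEquiv θ q p).mem_graph_quadrature (isClosable_schwartzQuadrature θ))).unique
      hE
  simpa only [one_mul, ← sub_eq_add_neg, coe_weylEquiv] using conj_eq

/-! ### Traces -/

section Trace

variable {ι κ K L M : Type*} [NormedAddCommGroup K] [InnerProductSpace ℂ K]
  [NormedAddCommGroup L] [InnerProductSpace ℂ L]

theorem clm_ext_hilbertBasis [NormedAddCommGroup M] [NormedSpace ℂ M] (e : HilbertBasis ι ℂ K)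
    {S T : K →L[ℂ] M} (h : ∀ i, S (e i) = T (e i)) : S = T :=
  ContinuousLinearMap.ext_on (Submodule.dense_iff_topologicalClosure_eq_top.2 e.dense_span)
    (Set.forall_mem_range.2 h)

theorem hasSum_norm_inner_sq (f : HilbertBasis κ ℂ L) (x : L) :
    HasSum (fun j => ‖⟪f j, x⟫_ℂ‖ ^ 2) (‖x‖ ^ 2) := by
  have parseval := f.hasSum_inner_mul_inner x x
  rw [inner_self_eq_norm_sq_to_K] at parseval
  refine Complex.hasSum_ofReal.1 ?_
  push_cast
  refine parseval.congr_fun fun j => ?_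
  rw [← inner_conj_symm, Complex.norm_conj, Complex.mul_conj']

theorem summable_norm_inner_sq (e : ι → K) (f : HilbertBasis κ ℂ L) {A : K →L[ℂ] L}
    (hA : Summable fun i => ‖A (e i)‖ ^ 2) :
    Summable fun z : ι × κ => ‖⟪f z.2, A (e z.1)⟫_ℂ‖ ^ 2 := by
  refine (summable_prod_of_nonneg fun z => by positivity).2
    ⟨fun i => (hasSum_norm_inner_sq f (A (e i))).summable, ?_⟩
  exact hA.congr fun i => (hasSum_norm_inner_sq f (A (e i))).tsum_eq.symm

variable [CompleteSpace K] [CompleteSpace L]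

/- The cyclicity `tr (A* B) = tr (B A*)`: the summability hypotheses say that `A` and `B` are
Hilbert–Schmidt operators. -/
theorem tsum_inner_eq_tsum_inner_adjoint (e : HilbertBasis ι ℂ K) (f : HilbertBasis κ ℂ L)
    {A B : L →L[ℂ] K} (hA : Summable fun i => ‖adjoint A (e i)‖ ^ 2)
    (hB : Summable fun i => ‖adjoint B (e i)‖ ^ 2) :
    ∑' j, ⟪A (f j), B (f j)⟫_ℂ = ∑' i, ⟪adjoint B (e i), adjoint A (e i)⟫_ℂ := by
  let F (i : ι) (j : κ) : ℂ := ⟪adjoint B (e i), f j⟫_ℂ * ⟪f j, adjoint A (e i)⟫_ℂ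
  have summable_F : Summable (Function.uncurry F) := by
    refine Summable.of_norm_bounded
      ((summable_norm_inner_sq e f hA).add (summable_norm_inner_sq e f hB)) fun z => ?_
    rw [Function.uncurry, norm_mul, norm_inner_symm]
    set a := ‖⟪f z.2, adjoint A (e z.1)⟫_ℂ‖
    set b := ‖⟪f z.2, adjoint B (e z.1)⟫_ℂ‖
    nlinarith [sq_nonneg (a - b), sq_nonneg a, sq_nonneg b]
  have tsum_f (i : ι) : ∑' j, F i j = ⟪adjoint B (e i), adjoint A (e i)⟫_ℂ :=
    f.tsum_inner_mul_inner _ _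
  have tsum_e (j : κ) : ∑' i, F i j = ⟪A (f j), B (f j)⟫_ℂ := by
    rw [← e.tsum_inner_mul_inner]
    refine tsum_congr fun i => ?_
    simp only [F, ContinuousLinearMap.adjoint_inner_left, ContinuousLinearMap.adjoint_inner_right]
    ring
  calc ∑' j, ⟪A (f j), B (f j)⟫_ℂ = ∑' j, ∑' i, F i j := by simp only [tsum_e]
    _ = ∑' i, ∑' j, F i j := summable_F.tsum_comm
    _ = _ := by simp only [tsum_f]

theorem tr_adjoint_comp_self_comp (e : HilbertBasis ι ℂ L) (A : K →L[ℂ] L)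
    (hA : Summable fun i => ‖adjoint A (e i)‖ ^ 2) (B : K →L[ℂ] K) :
    tr ((adjoint A ∘L A) ∘L B) = ∑' i, ⟪adjoint A (e i), B (adjoint A (e i))⟫_ℂ := by
  have hAB : Summable fun i => ‖adjoint (A ∘L B) (e i)‖ ^ 2 := by
    refine Summable.of_nonneg_of_le (fun i => by positivity) (fun i => ?_)
      (hA.mul_left (‖adjoint B‖ ^ 2))
    rw [ContinuousLinearMap.adjoint_comp, ← mul_pow]
    gcongr
    exact (adjoint B).le_opNorm _
  have cyclic := tsum_inner_eq_tsum_inner_adjoint e (onb K) hA hAB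
  simp only [ContinuousLinearMap.adjoint_comp, ContinuousLinearMap.comp_apply,
    ContinuousLinearMap.adjoint_inner_left B] at cyclic
  rw [tr, ← cyclic]
  simp only [ContinuousLinearMap.comp_apply, ContinuousLinearMap.adjoint_inner_right]

/-- The square root `√ρ` of a positive operator, given by the continuous functional calculus. It is
stated for abstract Hilbert spaces, where the instances of the functional calculus are found. -/
def sqrtOp (ρ : K →L[ℂ] K) : K →L[ℂ] K := CFC.sqrt ρ

theorem adjoint_sqrtOp (ρ : K →L[ℂ] K) : adjoint (sqrtOp ρ) = sqrtOp ρ :=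
  (IsSelfAdjoint.of_nonneg (CFC.sqrt_nonneg (a := ρ))).star_eq

namespace IsState

variable {ρ : K →L[ℂ] K}

theorem sqrtOp_comp_sqrtOp (hρ : IsState ρ) : sqrtOp ρ ∘L sqrtOp ρ = ρ :=
  CFC.sqrt_mul_sqrt_self ρ ((ContinuousLinearMap.nonneg_iff_isPositive ρ).2 hρ.isPositive)

theorem hasSum_norm_sqrtOp_sq (hρ : IsState ρ) :
    HasSum (fun i => ‖sqrtOp ρ (onb K i)‖ ^ 2) 1 := by
  refine Complex.hasSum_ofReal.1 (hρ.hasSum_one.congr_fun fun i => ?_)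
  conv_rhs => rw [← hρ.sqrtOp_comp_sqrtOp, ContinuousLinearMap.comp_apply,
    ← ContinuousLinearMap.adjoint_inner_left, adjoint_sqrtOp, inner_self_eq_norm_sq_to_K]
  push_cast
  rfl

theorem tr_comp (hρ : IsState ρ) (B : K →L[ℂ] K) :
    tr (ρ ∘L B) = ∑' i, ⟪sqrtOp ρ (onb K i), B (sqrtOp ρ (onb K i))⟫_ℂ := by
  have tr_eq := tr_adjoint_comp_self_comp (onb K) (sqrtOp ρ)
    (by rw [adjoint_sqrtOp]; exact hρ.hasSum_norm_sqrtOp_sq.summable) B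
  rwa [adjoint_sqrtOp, hρ.sqrtOp_comp_sqrtOp] at tr_eq

end IsState

theorem isState_rankOne {ψ : K} (h : ‖ψ‖ = 1) : IsState (InnerProductSpace.rankOne ℂ ψ ψ) where
  isPositive := InnerProductSpace.isPositive_rankOne_self ψ
  hasSum_one := by
    have parseval := (onb K).hasSum_inner_mul_inner ψ ψ
    rw [inner_self_eq_norm_sq_to_K, h] at parseval
    simpa [inner_smul_right] using parseval

theorem tr_rankOne_comp (ψ : K) (B : K →L[ℂ] K) :
    tr (InnerProductSpace.rankOne ℂ ψ ψ ∘L B) = ⟪ψ, B ψ⟫_ℂ := by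
  rw [← ContinuousLinearMap.adjoint_inner_left, ← (onb K).tsum_inner_mul_inner, tr]
  refine tsum_congr fun i => ?_
  simp [ContinuousLinearMap.adjoint_inner_left]

theorem eq_of_forall_tr_eq {B C : K →L[ℂ] K}
    (h : ∀ ρ : K →L[ℂ] K, IsState ρ → tr (ρ ∘L B) = tr (ρ ∘L C)) : B = C := by
  refine clm_ext_inner_self fun ψ => ?_
  rcases eq_or_ne ψ 0 with rfl | hψ
  · simp
  have inner_normalized := h _ (isState_rankOne (norm_smul_inv_norm (𝕜 := ℂ) hψ))
  rw [tr_rankOne_comp, tr_rankOne_comp] at inner_normalized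
  simpa [inner_smul_left, inner_smul_right, hψ] using inner_normalized

end Trace

/-- The Hilbert basis `e i ⊗ e' j` of `L²(ℝ²)`, used to compute traces of tensor products. -/
def tensorBasis {ι κ : Type*} (e : HilbertBasis ι ℂ H) (e' : HilbertBasis κ ℂ H) :
    HilbertBasis (ι × κ) ℂ H₂ :=
  HilbertBasis.mkOfOrthogonalEqBot (v := fun k : ι × κ => tprod (e k.1) (e' k.2))
    (by
      classical
      rw [orthonormal_iff_ite]
      rintro ⟨i, j⟩ ⟨i', j'⟩
      rw [inner_tprod, orthonormal_iff_ite.1 e.orthonormal, orthonormal_iff_ite.1 e'.orthonormal,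
        ite_zero_mul_ite_zero, one_mul]
      simp only [Prod.mk.injEq])
    (by
      refine (Submodule.eq_bot_iff _).2 fun Φ hΦ => ?_
      rw [Submodule.mem_orthogonal'] at hΦ
      have inner_basis (i : ι) (j : κ) : ⟪Φ, tprod (e i) (e' j)⟫_ℂ = 0 :=
        hΦ _ (Submodule.subset_span ⟨(i, j), rfl⟩)
      have comp_tprodLeft (j : κ) : innerSL ℂ Φ ∘L tprodLeft (e' j) = 0 :=
        clm_ext_hilbertBasis e fun i => inner_basis i j
      have comp_tprodRight (f : H) : innerSL ℂ Φ ∘L tprodRight f = 0 :=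
        clm_ext_hilbertBasis e' fun j => DFunLike.congr_fun (comp_tprodLeft j) f
      have innerSL_eq : innerSL ℂ Φ = 0 :=
        clm_ext_tprod fun f g => DFunLike.congr_fun (comp_tprodRight f) g
      exact inner_self_eq_zero.1 (DFunLike.congr_fun innerSL_eq Φ))

theorem tensorBasis_apply {ι κ : Type*} (e : HilbertBasis ι ℂ H) (e' : HilbertBasis κ ℂ H)
    (k : ι × κ) : tensorBasis e e' k = tprod (e k.1) (e' k.2) := by
  simp [tensorBasis]

/-! ### Joint observables -/

/-- `G` is the joint observable `Q ⊗ Q'` of two observables measured on the two factors of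
`L²(ℝ²)`. -/
def IsJointObservable (G : Observable H₂ (ℝ × ℝ)) (Q Q' : Observable H ℝ) : Prop :=
  ∀ A B, MeasurableSet A → MeasurableSet B → G.effect (A ×ˢ B) = tensorOp (Q.effect A) (Q'.effect B)

theorem isJointObservable_canonicalObservable :
    IsJointObservable (canonicalObservable volume) (canonicalObservable volume)
      (canonicalObservable volume) :=
  fun _ _ hA hB => (tensorOp_canonicalObservable hA hB).symm

theorem adjoint_tensorOp_comp_tensorOp {V V' : H →L[ℂ] H} (hV : adjoint V ∘L V = 1)
    (hV' : adjoint V' ∘L V' = 1) : adjoint (tensorOp V V') ∘L tensorOp V V' = 1 := by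
  rw [tensorOp_adjoint, tensorOp_comp, hV, hV']
  exact clm_ext_tprod fun f g => tensorOp_tprod 1 1 f g

namespace IsJointObservable

variable {G F : Observable H₂ (ℝ × ℝ)} {Q Q' : Observable H ℝ}

theorem unique (hG : IsJointObservable G Q Q') (hF : IsJointObservable F Q Q') : G = F :=
  Observable.ext_of_prod fun _ _ hA hB => (hG _ _ hA hB).trans (hF _ _ hA hB).symm

theorem map (hG : IsJointObservable G Q Q') {f f' : ℝ → ℝ} (hf : Measurable f)
    (hf' : Measurable f') :
    IsJointObservable (G.map (Prod.map f f') (hf.prodMap hf')) (Q.map f hf) (Q'.map f' hf') :=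
  fun A B hA hB => by
    rw [Observable.map_effect _ _ (hA.prod hB), Observable.map_effect _ _ hA,
      Observable.map_effect _ _ hB, ← hG _ _ (hf hA) (hf' hB)]
    rfl

theorem conj (hG : IsJointObservable G Q Q') {V V' : H →L[ℂ] H} (hV : adjoint V ∘L V = 1)
    (hV' : adjoint V' ∘L V' = 1) :
    IsJointObservable (G.conj (tensorOp V V') (adjoint_tensorOp_comp_tensorOp hV hV'))
      (Q.conj V hV) (Q'.conj V' hV') := fun A B hA hB => by
  simp only [Observable.conj_effect, hG A B hA hB, tensorOp_adjoint, tensorOp_comp]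

theorem map_sub_conj_weyl {θ θ' : ℝ} (hG : IsJointObservable G Q Q')
    (hQ : Q.IsSpectralMeasure (quadrature θ)) (hQ' : Q'.IsSpectralMeasure (quadrature θ'))
    (q p : ℝ) :
    (G.map (fun z => z - (q * Real.cos θ + p * Real.sin θ, q * Real.cos θ' + p * Real.sin θ'))
      (by fun_prop)).conj (tensorOp (weyl q p) (weyl q p))
        (adjoint_tensorOp_comp_tensorOp (adjoint_weyl_comp_weyl q p)
          (adjoint_weyl_comp_weyl q p)) = G := by
  have joint := (hG.map (f := (· - (q * Real.cos θ + p * Real.sin θ)))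
    (f' := (· - (q * Real.cos θ' + p * Real.sin θ'))) (by fun_prop) (by fun_prop)).conj
      (adjoint_weyl_comp_weyl q p) (adjoint_weyl_comp_weyl q p)
  rw [hQ.map_sub_conj_weyl, hQ'.map_sub_conj_weyl] at joint
  exact joint.unique hG

end IsJointObservable

theorem exists_isJointObservable_quadrature (θ θ' : ℝ) :
    ∃ (G : Observable H₂ (ℝ × ℝ)) (Q Q' : Observable H ℝ), IsJointObservable G Q Q' ∧
      Q.IsSpectralMeasure (quadrature θ) ∧ Q'.IsSpectralMeasure (quadrature θ') := by
  obtain ⟨V, κ, s, S, h⟩ := exists_intertwines_zero θ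
  obtain ⟨V', κ', s', S', h'⟩ := exists_intertwines_zero θ'
  exact ⟨_, _, _, (isJointObservable_canonicalObservable.map _ _).conj _ _,
    canonicalObservable_isSpectralMeasure.conj_map V h.ne_zero s
      (h.mem_graph_quadrature isClosable_schwartzQuadrature_zero),
    canonicalObservable_isSpectralMeasure.conj_map V' h'.ne_zero s'
      (h'.mem_graph_quadrature isClosable_schwartzQuadrature_zero)⟩

/-! ### The signal observable -/

/-- The operator `φ ↦ U (φ ⊗ χ)`: the signal `φ` enters the beam splitter together with a
parameter field in the vector state `χ`. -/
def beamSplitterLeft (χ : H) : H →L[ℂ] H₂ := beamSplitter ∘L tprodLeft χ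

theorem beamSplitterLeft_apply (φ χ : H) : beamSplitterLeft χ φ = beamSplitter (tprod φ χ) := rfl

theorem norm_beamSplitterLeft_apply (φ χ : H) : ‖beamSplitterLeft χ φ‖ = ‖φ‖ * ‖χ‖ :=
  ((Lp.compMeasurePreservingₗᵢ ℂ rot measurePreserving_rot).norm_map _).trans (norm_tprod φ χ)

theorem norm_beamSplitterLeft_le (χ : H) : ‖beamSplitterLeft χ‖ ≤ ‖χ‖ :=
  ContinuousLinearMap.opNorm_le_bound _ (norm_nonneg _) fun φ => by
    rw [norm_beamSplitterLeft_apply, mul_comm]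

theorem beamSplitterLeft_comp_weyl (χ : H) (q p : ℝ) :
    beamSplitterLeft χ ∘L weyl q p = tensorOp (weyl (q / Real.sqrt 2) (p / Real.sqrt 2))
      (weyl (q / Real.sqrt 2) (p / Real.sqrt 2)) ∘L beamSplitterLeft χ := by
  ext1 φ
  have conj_eq := DFunLike.congr_fun (beamSplitter_comp_tensorOp_weyl_one q p) (tprod φ χ)
  rwa [ContinuousLinearMap.comp_apply, tensorOp_tprod] at conj_eq

namespace IsState

variable {ρ σ : H →L[ℂ] H}

theorem summable_norm_beamSplitterLeft_sq (hσ : IsState σ) :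
    Summable fun k => ‖beamSplitterLeft (sqrtOp σ (onb H k))‖ ^ 2 :=
  hσ.hasSum_norm_sqrtOp_sq.summable.of_nonneg_of_le (fun k => by positivity) fun k => by
    gcongr
    exact norm_beamSplitterLeft_le _

theorem hasSum_norm_beamSplitterLeft_apply_sq (hσ : IsState σ) (φ : H) :
    HasSum (fun k => ‖beamSplitterLeft (sqrtOp σ (onb H k)) φ‖ ^ 2) (‖φ‖ ^ 2) := by
  simpa only [norm_beamSplitterLeft_apply, mul_pow, mul_one] using
    hσ.hasSum_norm_sqrtOp_sq.mul_left (‖φ‖ ^ 2)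

theorem summable_norm_beamSplitterLeft_apply_sq (hρ : IsState ρ) (hσ : IsState σ) :
    Summable fun z : _ × _ =>
      ‖beamSplitterLeft (sqrtOp σ (onb H z.2)) (sqrtOp ρ (onb H z.1))‖ ^ 2 := by
  simpa only [norm_beamSplitterLeft_apply, mul_pow] using
    hρ.hasSum_norm_sqrtOp_sq.summable.mul_of_nonneg hσ.hasSum_norm_sqrtOp_sq.summable
      (fun _ => by positivity) (fun _ => by positivity)

theorem tr_beamSplitter_conj_comp (hρ : IsState ρ) (hσ : IsState σ) (G : H₂ →L[ℂ] H₂) :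
    tr ((beamSplitter ∘L tensorOp ρ σ ∘L adjoint beamSplitter) ∘L G) =
      ∑' z : _ × _, ⟪beamSplitterLeft (sqrtOp σ (onb H z.2)) (sqrtOp ρ (onb H z.1)),
        G (beamSplitterLeft (sqrtOp σ (onb H z.2)) (sqrtOp ρ (onb H z.1)))⟫_ℂ := by
  set A : H₂ →L[ℂ] H₂ := tensorOp (sqrtOp ρ) (sqrtOp σ) ∘L adjoint beamSplitter with hA
  have adjoint_A : adjoint A = beamSplitter ∘L tensorOp (sqrtOp ρ) (sqrtOp σ) := by
    rw [hA, ContinuousLinearMap.adjoint_comp, ContinuousLinearMap.adjoint_adjoint,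
      tensorOp_adjoint, adjoint_sqrtOp, adjoint_sqrtOp]
  have adjoint_A_comp_A :
      beamSplitter ∘L tensorOp ρ σ ∘L adjoint beamSplitter = adjoint A ∘L A := by
    rw [adjoint_A, hA, ContinuousLinearMap.comp_assoc,
      ← ContinuousLinearMap.comp_assoc (tensorOp _ _), tensorOp_comp, hρ.sqrtOp_comp_sqrtOp,
      hσ.sqrtOp_comp_sqrtOp]
  have adjoint_A_basis (z : _ × _) : adjoint A (tensorBasis (onb H) (onb H) z) =
      beamSplitterLeft (sqrtOp σ (onb H z.2)) (sqrtOp ρ (onb H z.1)) := by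
    rw [adjoint_A, tensorBasis_apply, ContinuousLinearMap.comp_apply, tensorOp_tprod,
      beamSplitterLeft_apply]
  rw [adjoint_A_comp_A, tr_adjoint_comp_self_comp (tensorBasis (onb H) (onb H)) A
    (by simpa only [adjoint_A_basis] using hρ.summable_norm_beamSplitterLeft_apply_sq hσ)]
  simp only [adjoint_A_basis]

end IsState

theorem summable_inner_apply {ι K : Type*} [NormedAddCommGroup K] [InnerProductSpace ℂ K]
    {v : ι → K} (hv : Summable fun i => ‖v i‖ ^ 2) (G : K →L[ℂ] K) :
    Summable fun i => ⟪v i, G (v i)⟫_ℂ := by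
  refine (hv.mul_left ‖G‖).of_norm_bounded fun i => ?_
  calc ‖⟪v i, G (v i)⟫_ℂ‖ ≤ ‖v i‖ * (‖G‖ * ‖v i‖) :=
        (norm_inner_le_norm _ _).trans (by gcongr; exact G.le_opNorm _)
    _ = ‖G‖ * ‖v i‖ ^ 2 := by ring

theorem image_div_sqrt_two (X : Set ℝ) :
    (fun x => x / Real.sqrt 2) '' X = (fun x => Real.sqrt 2 * x) ⁻¹' X :=
  have sqrt_two_ne_zero : Real.sqrt 2 ≠ 0 := by positivity
  congrFun (Set.image_eq_preimage_of_inverse (fun x => mul_div_cancel₀ x sqrt_two_ne_zero)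
    fun x => mul_div_cancel_left₀ x sqrt_two_ne_zero) X

/-- The observable of the signal field obtained when the outputs of the beam splitter are measured
by `G`, the outcomes are multiplied by `√2`, and the parameter field is in the state `σ`. -/
def signalObservable (G : Observable H₂ (ℝ × ℝ)) {σ : H →L[ℂ] H} (hσ : IsState σ) :
    Observable H (ℝ × ℝ) :=
  (G.map (fun z => Real.sqrt 2 • z) (by fun_prop)).sumConj hσ.summable_norm_beamSplitterLeft_sq
    hσ.hasSum_norm_beamSplitterLeft_apply_sq

theorem tr_comp_signalObservable_effect (G : Observable H₂ (ℝ × ℝ)) {ρ σ : H →L[ℂ] H}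
    (hρ : IsState ρ) (hσ : IsState σ) {Z : Set (ℝ × ℝ)} (hZ : MeasurableSet Z) :
    tr (ρ ∘L (signalObservable G hσ).effect Z) =
      tr ((beamSplitter ∘L tensorOp ρ σ ∘L adjoint beamSplitter) ∘L
        G.effect ((fun z => Real.sqrt 2 • z) ⁻¹' Z)) := by
  rw [hρ.tr_comp, hρ.tr_beamSplitter_conj_comp hσ, Summable.tsum_prod
    (summable_inner_apply (hρ.summable_norm_beamSplitterLeft_apply_sq hσ) _)]
  refine tsum_congr fun j => ?_
  rw [← Observable.map_effect G _ hZ]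
  exact (Observable.hasSum_inner_sumConj _ _ _ Z _ _).tsum_eq.symm

theorem IsJointObservable.isHighAmplitudeObservable {G : Observable H₂ (ℝ × ℝ)}
    {Q Qθ : Observable H ℝ} {θ : ℝ} {σ : H →L[ℂ] H} (hG : IsJointObservable G Q Qθ)
    (hQ : Q.IsSpectralMeasure (quadrature 0)) (hQθ : Qθ.IsSpectralMeasure (quadrature θ))
    (hσ : IsState σ) : IsHighAmplitudeObservable θ σ (signalObservable G hσ) := by
  refine ⟨Q, Qθ, hQ, hQθ, fun ρ hρ X Y hX hY => ?_⟩
  rw [tr_comp_signalObservable_effect G hρ hσ (hX.prod hY), image_div_sqrt_two,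
    image_div_sqrt_two, ← hG _ _ (measurable_const_mul _ hX) (measurable_const_mul _ hY)]
  rfl

theorem IsHighAmplitudeObservable.unique {θ : ℝ} {σ : H →L[ℂ] H} {E F : Observable H (ℝ × ℝ)}
    (hE : IsHighAmplitudeObservable θ σ E) (hF : IsHighAmplitudeObservable θ σ F) : E = F := by
  obtain ⟨Q, Qθ, hQ, hQθ, hE⟩ := hE
  obtain ⟨Q', Qθ', hQ', hQθ', hF⟩ := hF
  obtain rfl := hQ.unique hQ'
  obtain rfl := hQθ.unique hQθ'
  exact Observable.ext_of_prod fun X Y hX hY => eq_of_forall_tr_eq fun ρ hρ =>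
    (hE ρ hρ X Y hX hY).trans (hF ρ hρ X Y hX hY).symm

/-! ### Covariance -/

theorem image_add_eq_preimage_sub {M : Type*} [AddCommGroup M] (v : M) (Z : Set M) :
    (fun z => z + v) '' Z = (fun z => z - v) ⁻¹' Z := by
  simp only [Set.image_add_right, sub_eq_add_neg]

namespace IsJointObservable

variable {G : Observable H₂ (ℝ × ℝ)} {Q Qθ : Observable H ℝ} {θ : ℝ} {σ : H →L[ℂ] H}

theorem adjoint_weyl_comp_signalObservable_effect (hG : IsJointObservable G Q Qθ)
    (hQ : Q.IsSpectralMeasure (quadrature 0)) (hQθ : Qθ.IsSpectralMeasure (quadrature θ))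
    (hσ : IsState σ) (q p : ℝ) {Z : Set (ℝ × ℝ)} (hZ : MeasurableSet Z) :
    adjoint (weyl q p) ∘L (signalObservable G hσ).effect
      ((fun z => z - (q, q * Real.cos θ + p * Real.sin θ)) ⁻¹' Z) ∘L weyl q p =
        (signalObservable G hσ).effect Z := by
  have measurable_scale : Measurable fun z : ℝ × ℝ => Real.sqrt 2 • z := by fun_prop
  have scale_shift : (fun z : ℝ × ℝ => Real.sqrt 2 • z) ⁻¹'
        ((fun z => z - (q, q * Real.cos θ + p * Real.sin θ)) ⁻¹' Z) =
      (fun z => z - (q / Real.sqrt 2 * Real.cos 0 + p / Real.sqrt 2 * Real.sin 0,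
        q / Real.sqrt 2 * Real.cos θ + p / Real.sqrt 2 * Real.sin θ)) ⁻¹'
          ((fun z => Real.sqrt 2 • z) ⁻¹' Z) := by
    rw [Set.preimage_preimage, Set.preimage_preimage]
    congr! 2 with z
    ext <;>
      simp only [Prod.fst_sub, Prod.snd_sub, Prod.smul_fst, Prod.smul_snd, smul_eq_mul,
        Real.cos_zero, Real.sin_zero, mul_one, mul_zero, add_zero] <;>
      field_simp
  refine Observable.adjoint_comp_sumConj_effect_comp _ _ _
    (fun k => beamSplitterLeft_comp_weyl _ q p) ?_
  rw [Observable.map_effect _ _ (hZ.preimage (measurable_sub_const _)),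
    Observable.map_effect _ _ hZ, scale_shift,
    ← Observable.map_effect _ (measurable_sub_const _) (measurable_scale hZ)]
  exact congrArg (fun E : Observable H₂ (ℝ × ℝ) => E.effect _)
    (hG.map_sub_conj_weyl hQ hQθ (q / Real.sqrt 2) (p / Real.sqrt 2))

theorem weyl_comp_signalObservable_effect (hG : IsJointObservable G Q Qθ)
    (hQ : Q.IsSpectralMeasure (quadrature 0)) (hQθ : Qθ.IsSpectralMeasure (quadrature θ))
    (hσ : IsState σ) (q p : ℝ) {Z : Set (ℝ × ℝ)} (hZ : MeasurableSet Z) :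
    weyl q p ∘L (signalObservable G hσ).effect Z ∘L adjoint (weyl q p) =
      (signalObservable G hσ).effect
        ((fun z => z + (q, q * Real.cos θ + p * Real.sin θ)) '' Z) := by
  rw [image_add_eq_preimage_sub, ← hG.adjoint_weyl_comp_signalObservable_effect hQ hQθ hσ q p hZ]
  have weyl_adjoint_apply (φ : H) : weyl q p (adjoint (weyl q p) φ) = φ :=
    DFunLike.congr_fun (weyl_comp_adjoint_weyl q p) φ
  ext1 φ
  simp only [ContinuousLinearMap.comp_apply, weyl_adjoint_apply]

end IsJointObservable

-- Almost every point of a slab `g ⁻¹' [n, n + 1)` would have to return to it.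
theorem measure_eq_zero_of_map_eq_add_one {α : Type*} [MeasurableSpace α] {μ : Measure α}
    [IsFiniteMeasure μ] {f : α → α} (hf : MeasurePreserving f μ μ) {g : α → ℝ}
    (hg : Measurable g) (hgf : ∀ x, g (f x) = g x + 1) : μ = 0 := by
  have measure_slab (n : ℤ) : μ (g ⁻¹' Set.Ico n (n + 1)) = 0 := by
    by_contra pos
    obtain ⟨x, hx, m, hm, hmx⟩ := hf.exists_mem_iterate_mem
      (hg measurableSet_Ico).nullMeasurableSet pos
    have g_iterate : g (f^[m] x) = g x + m := by
      have semiconj : Function.Semiconj g f (· + 1) := hgf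
      simpa using (semiconj.iterate_right m) x
    have one_le_m : (1 : ℝ) ≤ m := by exact_mod_cast Nat.one_le_iff_ne_zero.2 hm
    linarith [hx.1, hmx.2]
  have iUnion_slab : ⋃ n : ℤ, g ⁻¹' Set.Ico n (n + 1) = Set.univ := by
    rw [← Set.preimage_iUnion, iUnion_Ico_intCast, Set.preimage_univ]
  rw [← Measure.measure_univ_eq_zero, ← iUnion_slab]
  exact measure_iUnion_null measure_slab

theorem Observable.eq_zero_of_effect_preimage_sub {K : Type*} [NormedAddCommGroup K]
    [InnerProductSpace ℂ K] [Nontrivial K] {E : Observable K (ℝ × ℝ)} {t : ℝ}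
    (hE : ∀ Z, MeasurableSet Z → E.effect ((fun z => z - (0, t)) ⁻¹' Z) = E.effect Z) :
    t = 0 := by
  by_contra ht
  obtain ⟨ψ, hψ⟩ := exists_ne (0 : K)
  have measurePreserving_sub :
      MeasurePreserving (fun z => z - (0, t)) (E.measure ψ) (E.measure ψ) := by
    refine ⟨measurable_sub_const _, Measure.ext fun Z hZ => ?_⟩
    rw [Measure.map_apply (measurable_sub_const _) hZ,
      E.measure_apply ψ (measurable_sub_const _ hZ), hE Z hZ, E.measure_apply ψ hZ]
  have measure_eq_zero : E.measure ψ = 0 :=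
    measure_eq_zero_of_map_eq_add_one measurePreserving_sub (g := fun z => -(z.2 / t))
      (by fun_prop) fun z => by
        simp only [Prod.snd_sub]
        field_simp
        ring
  have norm_pos : 0 < E.measure ψ Set.univ := by
    rw [E.measure_univ, ENNReal.ofReal_pos]
    positivity
  simp [measure_eq_zero] at norm_pos

instance : Nontrivial H := by
  refine ⟨indicatorConstLp 2 measurableSet_Icc (measure_Icc_lt_top (a := 0) (b := 1)).ne 1, 0, ?_⟩
  rw [← norm_ne_zero_iff, norm_indicatorConstLp two_ne_zero ENNReal.ofNat_ne_top]
  simp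

theorem isCovariant_iff_sin_eq_one {θ : ℝ} {E : Observable H (ℝ × ℝ)}
    (hE : ∀ (q p : ℝ) (Z : Set (ℝ × ℝ)), MeasurableSet Z →
      weyl q p ∘L E.effect Z ∘L adjoint (weyl q p) =
        E.effect ((fun z => z + (q, q * Real.cos θ + p * Real.sin θ)) '' Z)) :
    IsCovariant E ↔ Real.sin θ = 1 := by
  constructor
  · intro hcov
    have effect_shift_sub (Z : Set (ℝ × ℝ)) (hZ : MeasurableSet Z) :
        E.effect ((fun z => z - (0, 1 - Real.sin θ)) ⁻¹' Z) = E.effect Z := by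
      have measurable_shift : MeasurableSet ((fun z => z - (0, -Real.sin θ)) ⁻¹' Z) :=
        measurable_sub_const _ hZ
      have effect_eq := (hcov 0 1 _ measurable_shift).symm.trans (hE 0 1 _ measurable_shift)
      simp only [image_add_eq_preimage_sub, Set.preimage_preimage, sub_sub] at effect_eq
      simpa [← sub_eq_add_neg, ← Prod.zero_eq_mk] using effect_eq
    linarith [Observable.eq_zero_of_effect_preimage_sub effect_shift_sub]
  · intro hsin q p Z hZ
    have hcos : Real.cos θ = 0 := Real.cos_eq_zero_iff_sin_eq.2 (.inl hsin)
    rw [hE q p Z hZ, hsin, hcos, mul_zero, mul_one, zero_add]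

theorem sin_eq_one_iff_exists (θ : ℝ) :
    Real.sin θ = 1 ↔ ∃ k : ℤ, θ = Real.pi / 2 + 2 * Real.pi * k := by
  simp only [Real.sin_eq_one_iff, eq_comm (a := θ), mul_comm (2 * Real.pi)]

theorem sin_eq_one_iff_of_mem_Ioc {θ : ℝ} (hθ : θ ∈ Set.Ioc (-Real.pi) Real.pi) :
    Real.sin θ = 1 ↔ θ = Real.pi / 2 := by
  rw [← Real.cos_sub_pi_div_two, Real.cos_eq_one_iff_of_lt_of_lt (by linarith [hθ.1, Real.pi_pos])
    (by linarith [hθ.2, Real.pi_pos]), sub_eq_zero]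

end EightPort

end

theorem mainTheorem2 (θ : ℝ) (σ : EightPort.H →L[ℂ] EightPort.H) (hσ : EightPort.IsState σ) :
    (∃! E : EightPort.Observable EightPort.H (ℝ × ℝ),
      EightPort.IsHighAmplitudeObservable θ σ E) ∧
    ∀ E : EightPort.Observable EightPort.H (ℝ × ℝ), EightPort.IsHighAmplitudeObservable θ σ E →
      (∀ (q p : ℝ) (Z : Set (ℝ × ℝ)), MeasurableSet Z →
        EightPort.weyl q p ∘L E.effect Z ∘L ContinuousLinearMap.adjoint (EightPort.weyl q p) =
          E.effect ((fun z => z + (q, q * Real.cos θ + p * Real.sin θ)) '' Z)) ∧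
      (EightPort.IsCovariant E ↔ ∃ k : ℤ, θ = Real.pi / 2 + 2 * Real.pi * k) ∧
      (θ ∈ Set.Ioc (-Real.pi) Real.pi → (EightPort.IsCovariant E ↔ θ = Real.pi / 2)) := by
  obtain ⟨G, Q, Qθ, hG, hQ, hQθ⟩ := EightPort.exists_isJointObservable_quadrature 0 θ
  have signal := hG.isHighAmplitudeObservable hQ hQθ hσ
  refine ⟨⟨_, signal, fun F hF => hF.unique signal⟩, fun E hE => ?_⟩
  obtain rfl := hE.unique signal
  have weyl_shift := fun q p (Z : Set (ℝ × ℝ)) =>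
    hG.weyl_comp_signalObservable_effect hQ hQθ hσ q p (Z := Z)
  have covariant_iff := EightPort.isCovariant_iff_sin_eq_one weyl_shift
  exact ⟨weyl_shift, covariant_iff.trans (EightPort.sin_eq_one_iff_exists θ),
    fun hθ => covariant_iff.trans (EightPort.sin_eq_one_iff_of_mem_Ioc hθ)⟩
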